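/- Let $\rho_1,\rho_2,k_1,k_2,k_3,l,L,a_0>0$ and $0<\beta<L$, and let $a=a_0$ on $(0,\beta)$, $a=0$ on $(\beta,L)$. On the space of complex-valued states $U=(v^1,\dots,v^6)$ $$\mathcal H=\bigl(H^1_0(0,L)\times L^2(0,L)\bigr)^3$$ put $$(U,\widetilde U)_{\mathcal H}=\int_0^L\Bigl\{k_1(v^1_x+v^3+lv^5)\overline{(\tilde v^1_x+\tilde v^3+l\tilde v^5)}+\rho_1v^2\overline{\tilde v^2}+k_2v^3_x\overline{\tilde v^3_x}+\rho_2v^4\overline{\tilde v^4}+k_3(v^5_x-lv^1)\overline{(\tilde v^5_x-l\tilde v^1)}+\rho_1v^6\overline{\tilde v^6}\Bigr\}\,dx .$$ Let $\mathcal A$ be the operator with domain $D(\mathcal A)=\bigl[(H^2(0,L)\cap H^1_0(0,L))\times H^1_0(0,L)\bigr]^3$ and $$\mathcal A\begin{pmatrix}v^1\\v^2\\v^3\\v^4\\v^5\\v^6\end{pmatrix}=\begin{pmatrix}v^2\\ \frac{k_1}{\rho_1}(v^1_x+v^3+lv^5)_x+\frac{lk_3}{\rho_1}(v^5_x-lv^1)\\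 v^4\\ \frac{k_2}{\rho_2}v^3_{xx}-\frac{k_1}{\rho_2}(v^1_x+v^3+lv^5)\\ v^6\\ \frac{k_3}{\rho_1}(v^5_x-lv^1)_x-\frac{lk_1}{\rho_1}(v^1_x+v^3+lv^5)-\frac{a}{\rho_1}v^6\end{pmatrix}.$$ Then: 1. $\mathcal H$ with $(\cdot,\cdot)_{\mathcal H}$ is a Hilbert space, $D(\mathcal A)$ is dense in $\mathcal H$, and $\mathcal A$ is m-dissipative: $\Re(\mathcal AU,U)_{\mathcal H}\le 0$ for all $U\in D(\mathcal A)$, and $\lambda I-\mathcal A:D(\mathcal A)\to\mathcal H$ is surjective for every $\lambda>0$. 2. $\mathcal A$ is the infinitesimal generator of a $C_0$-semigroup of contractions $(e^{t\mathcal A})_{t\ge0}$ on $\mathcal H$. 3. For every $U_0\in\mathcal H$, the problem $U_t=\mathcal AU$, $U(0)=U_0$, has a unique weak solution, namely $U(t)=e^{t\mathcal A}U_0\in C^0(\mathbb R^+,\mathcal H)$. Here $\mathbb R^+=[0,\infty)$, and a weak solution is a function $U\in C^0(\mathbb R^+,\mathcal H)$ with $U(0)=U_0$ such that for every $V\in D(\mathcal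 A^*)$ the function $t\mapsto(U(t),V)_{\mathcal H}$ is differentiable on $\mathbb R^+$ with derivative $(U(t),\mathcal A^*V)_{\mathcal H}$. 4. If $U_0\in D(\mathcal A)$, the problem has a unique strong solution, namely $U(t)=e^{t\mathcal A}U_0\in C^0(\mathbb R^+,D(\mathcal A))\cap C^1(\mathbb R^+,\mathcal H)$, where $D(\mathcal A)$ carries the graph norm. A strong solution is a function in this class with $U(0)=U_0$ and $U_t(t)=\mathcal AU(t)$ for all $t\ge0$. -/

import Mathlib

open Set Filter Topology MeasureTheory
open scoped ComplexConjugate InnerProductSpace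

noncomputable section

namespace Bresse

/-! ### Sobolev spaces on a bounded interval -/

/-- `L²(0, L)`, complex valued. -/
abbrev L2 (L : ℝ) : Type := Lp ℂ 2 (volume.restrict (Ioo (0 : ℝ) L))

/-- The open interval `(0, L)`. -/
def openInterval (L : ℝ) : TopologicalSpace.Opens ℝ := ⟨Ioo 0 L, isOpen_Ioo⟩

/-- Complex valued smooth functions with compact support in `(0, L)`. -/
abbrev TestFn (L : ℝ) : Type := TestFunction (openInterval L) ℂ ⊤

/-- `g` is the weak derivative of `u` on `(0, L)`. -/
def IsWeakDeriv (L : ℝ) (u g : L2 L) : Prop :=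
  ∀ φ : TestFn L, ∫ x in Ioo 0 L, u x * deriv φ x = -∫ x in Ioo 0 L, g x * φ x

theorem memLp_of_continuous (L : ℝ) {φ : ℝ → ℂ} (h : Continuous φ) :
    MemLp φ 2 (volume.restrict (Ioo 0 L)) := by
  obtain ⟨C, hC⟩ := (isCompact_Icc (a := (0 : ℝ)) (b := L)).exists_bound_of_continuousOn
    h.continuousOn
  refine MemLp.of_bound h.aestronglyMeasurable C ?_
  filter_upwards [ae_restrict_mem measurableSet_Ioo] with x hx
  exact hC x (Ioo_subset_Icc_self hx)

theorem integral_eq_inner (L : ℝ) (u : L2 L) {φ : ℝ → ℂ} (h : Continuous φ) :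
    ∫ x in Ioo 0 L, u x * φ x =
      inner ℂ ((memLp_of_continuous L (Complex.continuous_conj.comp h)).toLp _) u := by
  rw [L2.inner_def]
  refine integral_congr_ae ?_
  filter_upwards [(memLp_of_continuous L (Complex.continuous_conj.comp h)).coeFn_toLp] with x hx
  rw [hx]
  simp

theorem TestFn.continuous_deriv {L : ℝ} (φ : TestFn L) : Continuous (deriv φ) :=
  φ.contDiff.continuous_deriv (by simp)

/-- The graph of the weak derivative: pairs `(u, u')` in `L² × L²`. -/
def weakGraph (L : ℝ) : Submodule ℂ (L2 L × L2 L) where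
  carrier := {p | IsWeakDeriv L p.1 p.2}
  add_mem' := by
    intro p q hp hq φ
    have h1 := hp φ
    have h2 := hq φ
    rw [integral_eq_inner L _ φ.continuous_deriv, integral_eq_inner L _ φ.continuous] at h1 h2 ⊢
    rw [Prod.fst_add, Prod.snd_add, inner_add_right, inner_add_right, h1, h2]
    ring
  zero_mem' := by
    intro φ
    rw [integral_eq_inner L _ φ.continuous_deriv, integral_eq_inner L _ φ.continuous]
    simp
  smul_mem' := by
    intro c p hp φ
    have h1 := hp φ
    rw [integral_eq_inner L _ φ.continuous_deriv, integral_eq_inner L _ φ.continuous] at h1 ⊢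
    rw [Prod.smul_fst, Prod.smul_snd, inner_smul_right, inner_smul_right, h1]
    ring

/-- The weak derivative as an unbounded operator in `L²(0, L)`, with domain `H¹(0, L)`. -/
def weakDerivPMap (L : ℝ) : L2 L →ₗ.[ℂ] L2 L := (weakGraph L).toLinearPMap

/-- `H¹(0, L)`: the functions in `L²` having a weak derivative in `L²`. -/
def H1 (L : ℝ) : Submodule ℂ (L2 L) := (weakDerivPMap L).domain

/-- The weak derivative `H¹(0, L) → L²(0, L)`. -/
def weakDeriv (L : ℝ) : H1 L →ₗ[ℂ] L2 L := (weakDerivPMap L).toFun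

/-- The graph of the derivative on test functions: the pairs `(φ, φ')` in `L² × L²`. -/
def testGraph (L : ℝ) : Submodule ℂ (L2 L × L2 L) where
  carrier := {p | ∃ φ : TestFn L, p.1 =ᵐ[volume.restrict (Ioo 0 L)] φ ∧
    p.2 =ᵐ[volume.restrict (Ioo 0 L)] deriv φ}
  add_mem' := by
    rintro p q ⟨φ, h1, h2⟩ ⟨ψ, h3, h4⟩
    refine ⟨φ + ψ, ?_, ?_⟩
    · filter_upwards [h1, h3, Lp.coeFn_add p.1 q.1] with x a b c
      rw [Prod.fst_add, c, Pi.add_apply, a, b]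
      rfl
    · filter_upwards [h2, h4, Lp.coeFn_add p.2 q.2] with x a b c
      rw [Prod.snd_add, c, Pi.add_apply, a, b, FunLike.coe_add, deriv_add]
      · exact (φ.contDiff.differentiable (by simp)) x
      · exact (ψ.contDiff.differentiable (by simp)) x
  zero_mem' := by
    refine ⟨0, ?_, ?_⟩
    · filter_upwards [Lp.coeFn_zero ℂ 2 (volume.restrict (Ioo (0 : ℝ) L))] with x a
      rw [Prod.fst_zero, a]
      rfl
    · filter_upwards [Lp.coeFn_zero ℂ 2 (volume.restrict (Ioo (0 : ℝ) L))] with x a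
      rw [Prod.snd_zero, a, FunLike.coe_zero]
      simp
  smul_mem' := by
    rintro c p ⟨φ, h1, h2⟩
    refine ⟨c • φ, ?_, ?_⟩
    · filter_upwards [h1, Lp.coeFn_smul c p.1] with x a b
      rw [Prod.smul_fst, b, Pi.smul_apply, a]
      rfl
    · filter_upwards [h2, Lp.coeFn_smul c p.2] with x a b
      rw [Prod.smul_snd, b, Pi.smul_apply, a, FunLike.coe_smul,
        deriv_const_smul _ ((φ.contDiff.differentiable (by simp)) x)]

/-- `H¹₀(0, L)`: the closure of the test functions in the norm of `H¹(0, L)`, that is, the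
functions `u` with `φₙ → u` and `φₙ' → g` in `L²` for some test functions `φₙ` and some `g`. -/
def H10 (L : ℝ) : Submodule ℂ (L2 L) :=
  (testGraph L).topologicalClosure.map (LinearMap.fst ℂ (L2 L) (L2 L))

/-- The set underlying `H²(0, L)`: the functions in `H¹` whose derivative is in `H¹`. -/
def MemH2 (L : ℝ) (u : L2 L) : Prop := ∃ h : u ∈ H1 L, weakDeriv L ⟨u, h⟩ ∈ H1 L

theorem weakGraph_unique {L : ℝ} (p : L2 L × L2 L) (hp : p ∈ weakGraph L) (h0 : p.1 = 0) :
    p.2 = 0 := by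
  have key : ∀ᵐ x ∂volume, x ∈ Ioo (0 : ℝ) L → p.2 x = 0 := by
    refine isOpen_Ioo.ae_eq_zero_of_integral_contDiff_smul_eq_zero ?_ ?_
    · have : Integrable p.2 (volume.restrict (Ioo 0 L)) :=
        (Lp.memLp p.2).integrable (by norm_num)
      exact IntegrableOn.locallyIntegrableOn this
    · intro g hg hc hs
      let φ : TestFn L := ⟨fun x => (g x : ℂ), by
        exact Complex.ofRealCLM.contDiff.comp hg, hc.comp_left (g := Complex.ofReal) rfl,
        (tsupport_comp_subset (g := Complex.ofReal) rfl g).trans hs⟩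
      have h := hp φ
      rw [integral_eq_inner L _ φ.continuous_deriv, h0, inner_zero_right, eq_comm,
        neg_eq_zero] at h
      rw [← h, ← setIntegral_eq_integral_of_forall_compl_eq_zero (s := Ioo 0 L)]
      · refine integral_congr_ae (Eventually.of_forall fun x => ?_)
        exact Complex.real_smul.trans (mul_comm _ _)
      · intro x hx
        rw [image_eq_zero_of_notMem_tsupport (fun h => hx (hs h)), zero_smul]
  rw [Lp.eq_zero_iff_ae_eq_zero]
  exact (ae_restrict_iff' measurableSet_Ioo).2 key

theorem isWeakDeriv_weakDeriv {L : ℝ} (u : H1 L) : IsWeakDeriv L u (weakDeriv L u) :=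
  Submodule.mem_graph_toLinearPMap weakGraph_unique u

theorem weakDeriv_eq {L : ℝ} (u : H1 L) {g : L2 L} (h : IsWeakDeriv L u g) :
    weakDeriv L u = g := by
  have h1 : ((u : L2 L), weakDeriv L u) - ((u : L2 L), g) ∈ weakGraph L :=
    (weakGraph L).sub_mem (isWeakDeriv_weakDeriv u) h
  exact sub_eq_zero.1 (weakGraph_unique _ h1 (by simp))

/-- Integration by parts for limits of test functions, without a boundary term. -/
theorem closure_integral_by_parts {L : ℝ} {p : L2 L × L2 L}
    (hp : p ∈ (testGraph L).topologicalClosure) {φ φ' : ℝ → ℂ}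
    (hφ : ∀ x, HasDerivAt φ (φ' x) x) (hc : Continuous φ') :
    ∫ x in Ioo 0 L, p.1 x * φ' x = -∫ x in Ioo 0 L, p.2 x * φ x := by
  have hφc : Continuous φ := continuous_iff_continuousAt.2 fun x => (hφ x).continuousAt
  have hcl : IsClosed {p : L2 L × L2 L |
      ∫ x in Ioo 0 L, p.1 x * φ' x = -∫ x in Ioo 0 L, p.2 x * φ x} := by
    simp only [integral_eq_inner L _ hc, integral_eq_inner L _ hφc]
    exact isClosed_eq (continuous_const.inner continuous_fst)
      (continuous_const.inner continuous_snd).neg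
  have hsub : (testGraph L : Set (L2 L × L2 L)) ⊆ {p : L2 L × L2 L |
      ∫ x in Ioo 0 L, p.1 x * φ' x = -∫ x in Ioo 0 L, p.2 x * φ x} := by
    rintro q ⟨ψ, h1, h2⟩
    have e1 : ∫ x in Ioo 0 L, q.1 x * φ' x = ∫ x, ψ x * φ' x := by
      refine Eq.trans (integral_congr_ae (g := fun x => ψ x * φ' x) ?_)
        (setIntegral_eq_integral_of_forall_compl_eq_zero fun x hx => ?_)
      · filter_upwards [h1] with x hx
        rw [hx]
      · rw [image_eq_zero_of_notMem_tsupport (fun h => hx (ψ.tsupport_subset h)), zero_mul]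
    have e2 : ∫ x in Ioo 0 L, q.2 x * φ x = ∫ x, deriv ψ x * φ x := by
      refine Eq.trans (integral_congr_ae (g := fun x => deriv ψ x * φ x) ?_)
        (setIntegral_eq_integral_of_forall_compl_eq_zero fun x hx => ?_)
      · filter_upwards [h2] with x hx
        rw [hx]
      · have : x ∉ tsupport (deriv ψ) := fun h =>
          hx (ψ.tsupport_subset (closure_minimal support_deriv_subset isClosed_closure h))
        rw [image_eq_zero_of_notMem_tsupport this, zero_mul]
    change _ = _
    rw [e1, e2]
    refine integral_mul_deriv_eq_deriv_mul_of_integrable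
      (fun x _ => (ψ.contDiff.differentiable (by simp) x).hasDerivAt) (fun x _ => hφ x) ?_ ?_ ?_
    · exact (ψ.continuous.mul hc).integrable_of_hasCompactSupport ψ.hasCompactSupport.mul_right
    · exact (ψ.continuous_deriv.mul hφc).integrable_of_hasCompactSupport
        ψ.hasCompactSupport.deriv.mul_right
    · exact (ψ.continuous.mul hφc).integrable_of_hasCompactSupport ψ.hasCompactSupport.mul_right
  exact hcl.closure_subset_iff.2 hsub hp

theorem closure_le_weakGraph (L : ℝ) : (testGraph L).topologicalClosure ≤ weakGraph L :=
  fun _ hp φ => closure_integral_by_parts hp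
    (fun x => (φ.contDiff.differentiable (by simp) x).hasDerivAt) φ.continuous_deriv

theorem H10_le_H1 (L : ℝ) : H10 L ≤ H1 L :=
  Submodule.map_mono (closure_le_weakGraph L)

/-- The derivative `H¹₀(0, L) → L²(0, L)`. -/
def dx {L : ℝ} : H10 L →ₗ[ℂ] L2 L := weakDeriv L ∘ₗ Submodule.inclusion (H10_le_H1 L)

theorem MemH2.add {L : ℝ} {u v : L2 L} (hu : MemH2 L u) (hv : MemH2 L v) :
    MemH2 L (u + v) := by
  obtain ⟨h1, h2⟩ := hu
  obtain ⟨h3, h4⟩ := hv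
  refine ⟨add_mem h1 h3, ?_⟩
  rw [show (⟨u + v, add_mem h1 h3⟩ : H1 L) = ⟨u, h1⟩ + ⟨v, h3⟩ from rfl, map_add]
  exact add_mem h2 h4

theorem MemH2.smul {L : ℝ} {u : L2 L} (c : ℂ) (hu : MemH2 L u) : MemH2 L (c • u) := by
  obtain ⟨h1, h2⟩ := hu
  refine ⟨Submodule.smul_mem _ c h1, ?_⟩
  rw [show (⟨c • u, Submodule.smul_mem _ c h1⟩ : H1 L) = c • ⟨u, h1⟩ from rfl, map_smul]
  exact Submodule.smul_mem _ c h2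

theorem MemH2.zero {L : ℝ} : MemH2 L 0 :=
  ⟨zero_mem _, by rw [show (⟨0, zero_mem _⟩ : H1 L) = 0 from rfl, map_zero]; exact zero_mem _⟩

theorem mem_closure_testGraph {L : ℝ} (u : H10 L) :
    ((u : L2 L), dx u) ∈ (testGraph L).topologicalClosure := by
  obtain ⟨⟨v, g⟩, hp, hu⟩ := u.2
  have hu : v = u := hu
  subst hu
  have : dx u = g := weakDeriv_eq _ (closure_le_weakGraph L hp)
  rwa [this]

/-- The only `u ∈ H¹₀(0, L)` with `u' = i μ u` is `0`. -/
theorem H10_eq_zero {L : ℝ} (u : H10 L) (μ : ℝ) (h : dx u = (Complex.I * μ) • (u : L2 L)) :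
    u = 0 := by
  have key : ∀ᵐ x ∂volume, x ∈ Ioo (0 : ℝ) L → (u : L2 L) x = 0 := by
    refine isOpen_Ioo.ae_eq_zero_of_integral_contDiff_smul_eq_zero ?_ ?_
    · have : Integrable (u : L2 L) (volume.restrict (Ioo 0 L)) :=
        (Lp.memLp (u : L2 L)).integrable (by norm_num)
      exact IntegrableOn.locallyIntegrableOn this
    · intro g hg _ hs
      have he : Continuous fun s : ℝ => Complex.exp (Complex.I * μ * s) * (g s : ℂ) := by
        have := hg.continuous
        fun_prop
      let G : ℝ → ℂ := fun x => ∫ s in (0 : ℝ)..x, Complex.exp (Complex.I * μ * s) * (g s : ℂ)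
      have hG : ∀ x : ℝ, HasDerivAt G (Complex.exp (Complex.I * μ * x) * (g x : ℂ)) x :=
        fun x => intervalIntegral.integral_hasDerivAt_right (he.intervalIntegrable _ _)
          (he.stronglyMeasurableAtFilter _ _) he.continuousAt
      let φ : ℝ → ℂ := fun x => Complex.exp (-(Complex.I * μ * x)) * G x
      have hφ : ∀ x : ℝ, HasDerivAt φ ((g x : ℂ) - Complex.I * μ * φ x) x := by
        intro x
        have h1 : HasDerivAt (fun x : ℝ => -(Complex.I * μ * (x : ℂ))) (-(Complex.I * μ)) x := by
          refine ((Complex.ofRealCLM.hasDerivAt (x := x)).const_mul (Complex.I * μ)).neg.congr_deriv ?_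
          simp
        have h2 := h1.cexp.mul (hG x)
        refine h2.congr_deriv ?_
        have : Complex.exp (-(Complex.I * μ * x)) * Complex.exp (Complex.I * μ * x) = 1 := by
          rw [← Complex.exp_add]; simp
        simp only [φ]
        linear_combination (g x : ℂ) * this
      have hφc : Continuous φ := continuous_iff_continuousAt.2 fun x => (hφ x).continuousAt
      have hgc : Continuous fun x => (g x : ℂ) := Complex.continuous_ofReal.comp hg.continuous
      have hφ'c : Continuous fun x => (g x : ℂ) - Complex.I * μ * φ x := by fun_prop
      have hp := closure_integral_by_parts (mem_closure_testGraph u) hφ hφ'c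
      rw [h] at hp
      rw [integral_eq_inner L ((Complex.I * μ) • (u : L2 L)) hφc, inner_smul_right,
        ← integral_eq_inner L _ hφc] at hp
      have hi : ∀ {f : ℝ → ℂ}, Continuous f →
          Integrable (fun x => (u : L2 L) x * f x) (volume.restrict (Ioo 0 L)) :=
        fun hf => MemLp.integrable_mul (Lp.memLp (u : L2 L)) (memLp_of_continuous L hf)
      have hs1 : ∫ x in Ioo 0 L, (u : L2 L) x * ((g x : ℂ) - Complex.I * μ * φ x) =
          (∫ x in Ioo 0 L, (u : L2 L) x * (g x : ℂ)) -
            Complex.I * μ * ∫ x in Ioo 0 L, (u : L2 L) x * φ x := by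
        rw [← integral_const_mul, ← integral_sub (hi hgc) ((hi hφc).const_mul _)]
        congr 1
        ext x
        ring
      have hz : ∫ x in Ioo 0 L, (u : L2 L) x * (g x : ℂ) = 0 := by
        have := hs1.symm.trans hp
        linear_combination this
      rw [← hz, ← setIntegral_eq_integral_of_forall_compl_eq_zero (s := Ioo 0 L)]
      · refine integral_congr_ae (Eventually.of_forall fun x => ?_)
        simp [mul_comm]
      · intro x hx
        rw [image_eq_zero_of_notMem_tsupport (fun h => hx (hs h)), zero_smul]
  ext1
  rw [Submodule.coe_zero, Lp.eq_zero_iff_ae_eq_zero]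
  exact (ae_restrict_iff' measurableSet_Ioo).2 key

/-! ### The Bresse operator -/

/-- The physical coefficients, the length `L` of the beam, and the damping data `β`, `a₀`. -/
structure Params where
  (ρ₁ ρ₂ k₁ k₂ k₃ l L β a₀ : ℝ)
  ρ₁_pos : 0 < ρ₁
  ρ₂_pos : 0 < ρ₂
  k₁_pos : 0 < k₁
  k₂_pos : 0 < k₂
  k₃_pos : 0 < k₃
  l_pos : 0 < l
  L_pos : 0 < L
  β_pos : 0 < β
  β_lt : β < L
  a₀_pos : 0 < a₀

/-- The vector space `(H¹₀(0, L) × L²(0, L))³` of states `(v¹, …, v⁶)`. -/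
def State (p : Params) : Type :=
  H10 p.L × L2 p.L × H10 p.L × L2 p.L × H10 p.L × L2 p.L

namespace State

variable {p : Params}

instance : AddCommGroup (State p) :=
  inferInstanceAs (AddCommGroup (H10 p.L × L2 p.L × H10 p.L × L2 p.L × H10 p.L × L2 p.L))

instance : Module ℂ (State p) :=
  inferInstanceAs (Module ℂ (H10 p.L × L2 p.L × H10 p.L × L2 p.L × H10 p.L × L2 p.L))

/-- The state with the given six components. -/
def mk (v1 : H10 p.L) (v2 : L2 p.L) (v3 : H10 p.L) (v4 : L2 p.L) (v5 : H10 p.L) (v6 : L2 p.L) :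
    State p := (v1, v2, v3, v4, v5, v6)

/-- The component `v¹`. -/
def v1 (U : State p) : H10 p.L := U.1

/-- The component `v²`. -/
def v2 (U : State p) : L2 p.L := U.2.1

/-- The component `v³`. -/
def v3 (U : State p) : H10 p.L := U.2.2.1

/-- The component `v⁴`. -/
def v4 (U : State p) : L2 p.L := U.2.2.2.1

/-- The component `v⁵`. -/
def v5 (U : State p) : H10 p.L := U.2.2.2.2.1

/-- The component `v⁶`. -/
def v6 (U : State p) : L2 p.L := U.2.2.2.2.2

@[simp] theorem mk_v1 (a : H10 p.L) (b : L2 p.L) (c : H10 p.L) (d : L2 p.L) (e : H10 p.L)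
    (f : L2 p.L) : (mk a b c d e f).v1 = a := rfl
@[simp] theorem mk_v2 (a : H10 p.L) (b : L2 p.L) (c : H10 p.L) (d : L2 p.L) (e : H10 p.L)
    (f : L2 p.L) : (mk a b c d e f).v2 = b := rfl
@[simp] theorem mk_v3 (a : H10 p.L) (b : L2 p.L) (c : H10 p.L) (d : L2 p.L) (e : H10 p.L)
    (f : L2 p.L) : (mk a b c d e f).v3 = c := rfl
@[simp] theorem mk_v4 (a : H10 p.L) (b : L2 p.L) (c : H10 p.L) (d : L2 p.L) (e : H10 p.L)
    (f : L2 p.L) : (mk a b c d e f).v4 = d := rfl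
@[simp] theorem mk_v5 (a : H10 p.L) (b : L2 p.L) (c : H10 p.L) (d : L2 p.L) (e : H10 p.L)
    (f : L2 p.L) : (mk a b c d e f).v5 = e := rfl
@[simp] theorem mk_v6 (a : H10 p.L) (b : L2 p.L) (c : H10 p.L) (d : L2 p.L) (e : H10 p.L)
    (f : L2 p.L) : (mk a b c d e f).v6 = f := rfl

theorem ext {U V : State p} (h1 : U.v1 = V.v1) (h2 : U.v2 = V.v2) (h3 : U.v3 = V.v3)
    (h4 : U.v4 = V.v4) (h5 : U.v5 = V.v5) (h6 : U.v6 = V.v6) : U = V :=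
  Prod.ext h1 (Prod.ext h2 (Prod.ext h3 (Prod.ext h4 (Prod.ext h5 h6))))

@[simp] theorem v1_add (U V : State p) : (U + V).v1 = U.v1 + V.v1 := rfl
@[simp] theorem v2_add (U V : State p) : (U + V).v2 = U.v2 + V.v2 := rfl
@[simp] theorem v3_add (U V : State p) : (U + V).v3 = U.v3 + V.v3 := rfl
@[simp] theorem v4_add (U V : State p) : (U + V).v4 = U.v4 + V.v4 := rfl
@[simp] theorem v5_add (U V : State p) : (U + V).v5 = U.v5 + V.v5 := rfl
@[simp] theorem v6_add (U V : State p) : (U + V).v6 = U.v6 + V.v6 := rfl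
@[simp] theorem v1_smul (c : ℂ) (U : State p) : (c • U).v1 = c • U.v1 := rfl
@[simp] theorem v2_smul (c : ℂ) (U : State p) : (c • U).v2 = c • U.v2 := rfl
@[simp] theorem v3_smul (c : ℂ) (U : State p) : (c • U).v3 = c • U.v3 := rfl
@[simp] theorem v4_smul (c : ℂ) (U : State p) : (c • U).v4 = c • U.v4 := rfl
@[simp] theorem v5_smul (c : ℂ) (U : State p) : (c • U).v5 = c • U.v5 := rfl
@[simp] theorem v6_smul (c : ℂ) (U : State p) : (c • U).v6 = c • U.v6 := rfl
@[simp] theorem v1_zero : (0 : State p).v1 = 0 := rfl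
@[simp] theorem v2_zero : (0 : State p).v2 = 0 := rfl
@[simp] theorem v3_zero : (0 : State p).v3 = 0 := rfl
@[simp] theorem v4_zero : (0 : State p).v4 = 0 := rfl
@[simp] theorem v5_zero : (0 : State p).v5 = 0 := rfl
@[simp] theorem v6_zero : (0 : State p).v6 = 0 := rfl

/-- `v¹ₓ + v³ + l v⁵`. -/
def shear : State p →ₗ[ℂ] L2 p.L where
  toFun U := dx U.v1 + (U.v3 : L2 p.L) + (p.l : ℂ) • (U.v5 : L2 p.L)
  map_add' U V := by simp only [v1_add, v3_add, v5_add, map_add, Submodule.coe_add]; module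
  map_smul' c U := by
    simp only [v1_smul, v3_smul, v5_smul, map_smul, Submodule.coe_smul, RingHom.id_apply]; module

/-- `v⁵ₓ - l v¹`. -/
def axial : State p →ₗ[ℂ] L2 p.L where
  toFun U := dx U.v5 - (p.l : ℂ) • (U.v1 : L2 p.L)
  map_add' U V := by simp only [v1_add, v5_add, map_add, Submodule.coe_add]; module
  map_smul' c U := by
    simp only [v1_smul, v5_smul, map_smul, Submodule.coe_smul, RingHom.id_apply]; module

/-- The energy inner product, conjugate linear in the first argument:
`k₁ ∫ conj(v¹ₓ+v³+lv⁵) (w¹ₓ+w³+lw⁵) + ρ₁ ∫ conj(v²) w² + k₂ ∫ conj(v³ₓ) w³ₓ + ρ₂ ∫ conj(v⁴) w⁴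
+ k₃ ∫ conj(v⁵ₓ-lv¹) (w⁵ₓ-lw¹) + ρ₁ ∫ conj(v⁶) w⁶`. -/
def energyInner (V W : State p) : ℂ :=
  p.k₁ * ⟪V.shear, W.shear⟫_ℂ + p.ρ₁ * ⟪V.v2, W.v2⟫_ℂ + p.k₂ * ⟪dx V.v3, dx W.v3⟫_ℂ
    + p.ρ₂ * ⟪V.v4, W.v4⟫_ℂ + p.k₃ * ⟪V.axial, W.axial⟫_ℂ + p.ρ₁ * ⟪V.v6, W.v6⟫_ℂ

theorem energyInner_self (V : State p) : energyInner V V =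
    ((p.k₁ * ‖V.shear‖ ^ 2 + p.ρ₁ * ‖V.v2‖ ^ 2 + p.k₂ * ‖dx V.v3‖ ^ 2
      + p.ρ₂ * ‖V.v4‖ ^ 2 + p.k₃ * ‖V.axial‖ ^ 2 + p.ρ₁ * ‖V.v6‖ ^ 2 : ℝ) : ℂ) := by
  simp only [energyInner, inner_self_eq_norm_sq_to_K]
  push_cast
  rfl

theorem eq_zero_of_energy (V : State p) (h : energyInner V V = 0) : V = 0 := by
  rw [energyInner_self, Complex.ofReal_eq_zero] at h
  have a1 := mul_nonneg p.k₁_pos.le (sq_nonneg ‖V.shear‖)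
  have a2 := mul_nonneg p.ρ₁_pos.le (sq_nonneg ‖V.v2‖)
  have a3 := mul_nonneg p.k₂_pos.le (sq_nonneg ‖dx V.v3‖)
  have a4 := mul_nonneg p.ρ₂_pos.le (sq_nonneg ‖V.v4‖)
  have a5 := mul_nonneg p.k₃_pos.le (sq_nonneg ‖V.axial‖)
  have a6 := mul_nonneg p.ρ₁_pos.le (sq_nonneg ‖V.v6‖)
  have z : ∀ {c : ℝ} {f : L2 p.L}, 0 < c → c * ‖f‖ ^ 2 = 0 → f = 0 := by
    intro c f hc hf
    simpa [hc.ne'] using hf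
  have b1 : V.shear = 0 := z p.k₁_pos (by linarith)
  have b2 : V.v2 = 0 := z p.ρ₁_pos (by linarith)
  have b3 : dx V.v3 = 0 := z p.k₂_pos (by linarith)
  have b4 : V.v4 = 0 := z p.ρ₂_pos (by linarith)
  have b5 : V.axial = 0 := z p.k₃_pos (by linarith)
  have b6 : V.v6 = 0 := z p.ρ₁_pos (by linarith)
  have c3 : V.v3 = 0 := H10_eq_zero _ 0 (by simp [b3])
  have d1 : dx V.v1 = -((p.l : ℂ) • (V.v5 : L2 p.L)) := by
    have : dx V.v1 + (V.v3 : L2 p.L) + (p.l : ℂ) • (V.v5 : L2 p.L) = 0 := b1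
    rw [c3, Submodule.coe_zero, add_zero] at this
    exact eq_neg_of_add_eq_zero_left this
  have d5 : dx V.v5 = (p.l : ℂ) • (V.v1 : L2 p.L) := sub_eq_zero.1 b5
  have e1 : V.v1 + Complex.I • V.v5 = 0 := by
    refine H10_eq_zero _ p.l ?_
    rw [map_add, map_smul, d1, d5, Submodule.coe_add, Submodule.coe_smul, smul_add, smul_smul,
      smul_smul, mul_right_comm, Complex.I_mul_I]
    module
  have e2 : V.v1 - Complex.I • V.v5 = 0 := by
    refine H10_eq_zero _ (-p.l) ?_
    rw [map_sub, map_smul, d1, d5, Submodule.coe_sub, Submodule.coe_smul, smul_sub, smul_smul,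
      smul_smul, mul_right_comm, Complex.I_mul_I]
    push_cast
    module
  have c1 : V.v1 = 0 := by
    have h2 : (2 : ℂ) • V.v1 = (V.v1 + Complex.I • V.v5) + (V.v1 - Complex.I • V.v5) := by module
    rw [e1, e2, add_zero] at h2
    exact (smul_eq_zero.1 h2).resolve_left two_ne_zero
  have c5 : V.v5 = 0 := by
    rw [c1, zero_add] at e1
    exact (smul_eq_zero.1 e1).resolve_left Complex.I_ne_zero
  exact ext c1 b2 c3 b4 c5 b6

/-- The energy inner product is an inner product. -/
@[reducible] def energyCore : InnerProductSpace.Core ℂ (State p) where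
  inner := energyInner
  conj_inner_symm V W := by
    simp only [energyInner, map_add, map_mul, Complex.conj_ofReal, inner_conj_symm]
  re_inner_nonneg V := by
    rw [energyInner_self]
    rw [show ∀ x : ℝ, RCLike.re (x : ℂ) = x from Complex.ofReal_re]
    have a1 := mul_nonneg p.k₁_pos.le (sq_nonneg ‖V.shear‖)
    have a2 := mul_nonneg p.ρ₁_pos.le (sq_nonneg ‖V.v2‖)
    have a3 := mul_nonneg p.k₂_pos.le (sq_nonneg ‖dx V.v3‖)
    have a4 := mul_nonneg p.ρ₂_pos.le (sq_nonneg ‖V.v4‖)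
    have a5 := mul_nonneg p.k₃_pos.le (sq_nonneg ‖V.axial‖)
    have a6 := mul_nonneg p.ρ₁_pos.le (sq_nonneg ‖V.v6‖)
    exact add_nonneg (add_nonneg (add_nonneg (add_nonneg (add_nonneg a1 a2) a3) a4) a5) a6
  add_left U V W := by
    simp only [energyInner, map_add, v2_add, v3_add, v4_add, v6_add, inner_add_left]
    ring
  smul_left U V c := by
    simp only [energyInner, map_smul, v2_smul, v3_smul, v4_smul, v6_smul, inner_smul_left]
    ring
  definite V h := eq_zero_of_energy V h

instance : NormedAddCommGroup (State p) :=
  InnerProductSpace.Core.toNormedAddCommGroup (𝕜 := ℂ) (cd := energyCore)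

instance : InnerProductSpace ℂ (State p) := InnerProductSpace.ofCore energyCore.toCore

theorem inner_eq (V W : State p) : ⟪V, W⟫_ℂ = energyInner V W := rfl

end State

/-- The damping coefficient: `a = a₀` on `(0, β)` and `a = 0` on `(β, L)`. -/
def damping (p : Params) : ℝ → ℝ := (Ioo 0 p.β).indicator fun _ => p.a₀

theorem memLp_damping_mul (p : Params) (f : L2 p.L) :
    MemLp (fun x => (damping p x : ℂ) * f x) 2 (volume.restrict (Ioo 0 p.L)) := by
  have h : (fun x => (damping p x : ℂ) * f x) = (Ioo 0 p.β).indicator fun x => (p.a₀ : ℂ) * f x := by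
    ext x
    by_cases hx : x ∈ Ioo 0 p.β <;> simp [damping, hx]
  rw [h]
  exact ((Lp.memLp f).const_mul _).indicator measurableSet_Ioo

/-- The bounded operator `f ↦ a f` of `L²(0, L)`. -/
def mulDamping (p : Params) : L2 p.L →ₗ[ℂ] L2 p.L where
  toFun f := (memLp_damping_mul p f).toLp _
  map_add' f g := by
    rw [← MemLp.toLp_add]
    refine MemLp.toLp_congr _ _ ?_
    filter_upwards [Lp.coeFn_add f g] with x hx
    rw [hx, Pi.add_apply, Pi.add_apply]
    ring
  map_smul' c f := by
    rw [RingHom.id_apply, ← MemLp.toLp_const_smul]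
    refine MemLp.toLp_congr _ _ ?_
    filter_upwards [Lp.coeFn_smul c f] with x hx
    rw [hx, Pi.smul_apply, Pi.smul_apply, smul_eq_mul, smul_eq_mul]
    ring

/-- `D(A) = [(H² ∩ H¹₀) × H¹₀]³`. -/
def domainA (p : Params) : Submodule ℂ (State p) where
  carrier := {U | (MemH2 p.L U.v1 ∧ U.v2 ∈ H10 p.L) ∧ (MemH2 p.L U.v3 ∧ U.v4 ∈ H10 p.L) ∧
    (MemH2 p.L U.v5 ∧ U.v6 ∈ H10 p.L)}
  add_mem' := by
    rintro U V ⟨⟨a1, a2⟩, ⟨a3, a4⟩, a5, a6⟩ ⟨⟨b1, b2⟩, ⟨b3, b4⟩, b5, b6⟩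
    exact ⟨⟨a1.add b1, add_mem a2 b2⟩, ⟨a3.add b3, add_mem a4 b4⟩, a5.add b5, add_mem a6 b6⟩
  zero_mem' := ⟨⟨.zero, zero_mem _⟩, ⟨.zero, zero_mem _⟩, .zero, zero_mem _⟩
  smul_mem' := by
    rintro c U ⟨⟨a1, a2⟩, ⟨a3, a4⟩, a5, a6⟩
    exact ⟨⟨a1.smul c, Submodule.smul_mem _ c a2⟩, ⟨a3.smul c, Submodule.smul_mem _ c a4⟩,
      a5.smul c, Submodule.smul_mem _ c a6⟩

section

variable {p : Params}

theorem dx_mem_H1 {L : ℝ} {u : H10 L} (h : MemH2 L u) : dx u ∈ H1 L := h.2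

theorem shear_mem (U : domainA p) : (U : State p).shear ∈ H1 p.L :=
  add_mem (add_mem (dx_mem_H1 U.2.1.1) (H10_le_H1 _ (U : State p).v3.2))
    (Submodule.smul_mem _ _ (H10_le_H1 _ (U : State p).v5.2))

theorem axial_mem (U : domainA p) : (U : State p).axial ∈ H1 p.L :=
  sub_mem (dx_mem_H1 U.2.2.2.1) (Submodule.smul_mem _ _ (H10_le_H1 _ (U : State p).v1.2))

theorem dx_v3_mem (U : domainA p) : dx (U : State p).v3 ∈ H1 p.L := dx_mem_H1 U.2.2.1.1

/-- `(v¹ₓ + v³ + l v⁵)ₓ`. -/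
def shearDx : domainA p →ₗ[ℂ] L2 p.L :=
  weakDeriv p.L ∘ₗ LinearMap.codRestrict _ (State.shear ∘ₗ (domainA p).subtype) shear_mem

/-- `v³ₓₓ`. -/
def bendingDx : domainA p →ₗ[ℂ] L2 p.L where
  toFun U := weakDeriv p.L ⟨dx (U : State p).v3, dx_v3_mem U⟩
  map_add' U V := by rw [← map_add]; congr 1; ext1; exact map_add dx _ _
  map_smul' c U := by rw [RingHom.id_apply, ← map_smul]; congr 1; ext1; exact map_smul dx c _

/-- `(v⁵ₓ - l v¹)ₓ`. -/
def axialDx : domainA p →ₗ[ℂ] L2 p.L :=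
  weakDeriv p.L ∘ₗ LinearMap.codRestrict _ (State.axial ∘ₗ (domainA p).subtype) axial_mem

end

/-- The six components of `A U`, for `U ∈ D(A)`. -/
def applyA {p : Params} (U : domainA p) : State p :=
  State.mk
    ⟨(U : State p).v2, U.2.1.2⟩
    (((p.k₁ / p.ρ₁ : ℝ) : ℂ) • shearDx U
      + ((p.l * p.k₃ / p.ρ₁ : ℝ) : ℂ) • (U : State p).axial)
    ⟨(U : State p).v4, U.2.2.1.2⟩
    (((p.k₂ / p.ρ₂ : ℝ) : ℂ) • bendingDx U
      - ((p.k₁ / p.ρ₂ : ℝ) : ℂ) • (U : State p).shear)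
    ⟨(U : State p).v6, U.2.2.2.2⟩
    (((p.k₃ / p.ρ₁ : ℝ) : ℂ) • axialDx U
      - ((p.l * p.k₁ / p.ρ₁ : ℝ) : ℂ) • (U : State p).shear
      - ((1 / p.ρ₁ : ℝ) : ℂ) • mulDamping p (U : State p).v6)

/-- The Bresse operator `A` in the energy space, with domain `D(A)`. -/
def opA (p : Params) : State p →ₗ.[ℂ] State p where
  domain := domainA p
  toFun :=
    { toFun := applyA
      map_add' := by
        intro U V
        refine State.ext ?_ ?_ ?_ ?_ ?_ ?_ <;> simp only [applyA, State.mk_v1, State.mk_v2,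
          State.mk_v3, State.mk_v4, State.mk_v5, State.mk_v6, State.v1_add, State.v2_add,
          State.v3_add, State.v4_add, State.v5_add, State.v6_add, map_add, Submodule.coe_add]
        · rfl
        · module
        · rfl
        · module
        · rfl
        · module
      map_smul' := by
        intro c U
        refine State.ext ?_ ?_ ?_ ?_ ?_ ?_ <;> simp only [applyA, State.mk_v1, State.mk_v2,
          State.mk_v3, State.mk_v4, State.mk_v5, State.mk_v6, State.v1_smul, State.v2_smul,
          State.v3_smul, State.v4_smul, State.v5_smul, State.v6_smul, map_smul,
          Submodule.coe_smul, RingHom.id_apply]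
        · rfl
        · module
        · rfl
        · module
        · rfl
        · module }

/-! ### Dissipative operators, semigroups and solutions of evolution equations -/

section Evolution

variable {E : Type*} [NormedAddCommGroup E] [InnerProductSpace ℂ E]

/-- `A` is m-dissipative: `Re ⟨AU, U⟩ ≤ 0` on `D(A)`, and `λ - A` is onto for every `λ > 0`. -/
def IsMDissipative (A : E →ₗ.[ℂ] E) : Prop :=
  (∀ U : A.domain, (⟪(U : E), A U⟫_ℂ).re ≤ 0) ∧
    ∀ r : ℝ, 0 < r → ∀ F : E, ∃ U : A.domain, (r : ℂ) • (U : E) - A U = F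

/-- `(T t)_{t ≥ 0}` is a strongly continuous semigroup of contractions; the values `T t` for
`t < 0` play no role. -/
structure IsC0ContractionSemigroup (T : ℝ → E →L[ℂ] E) : Prop where
  zero : T 0 = ContinuousLinearMap.id ℂ E
  add : ∀ s t, 0 ≤ s → 0 ≤ t → T (s + t) = (T s).comp (T t)
  continuousOn : ∀ U : E, ContinuousOn (fun t => T t U) (Ici 0)
  contraction : ∀ t, 0 ≤ t → ‖T t‖ ≤ 1

/-- `A` is the infinitesimal generator of `T`: `U ∈ D(A)` and `AU = F` if and only if
`(T t U - U) / t → F` as `t → 0⁺`. -/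
def IsGenerator (A : E →ₗ.[ℂ] E) (T : ℝ → E →L[ℂ] E) : Prop :=
  ∀ U F : E, (U, F) ∈ A.graph ↔
    Tendsto (fun t : ℝ => (t : ℂ)⁻¹ • (T t U - U)) (𝓝[>] 0) (𝓝 F)

/-- `U : [0, ∞) → E` is a weak solution of `U' = AU`, `U(0) = U₀`: it is continuous and
`d/dt ⟨V, U(t)⟩ = ⟨A* V, U(t)⟩` for all `V ∈ D(A*)`. The pairs `(V, W)` below are those with
`V ∈ D(A*)` and `A* V = W`. -/
def IsWeakSolution (A : E →ₗ.[ℂ] E) (U₀ : E) (U : ℝ → E) : Prop :=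
  ContinuousOn U (Ici 0) ∧ U 0 = U₀ ∧
    ∀ V W : E, (∀ X : A.domain, ⟪W, (X : E)⟫_ℂ = ⟪V, A X⟫_ℂ) →
      ∀ t : ℝ, 0 ≤ t → HasDerivWithinAt (fun s => ⟪V, U s⟫_ℂ) ⟪W, U t⟫_ℂ (Ici 0) t

/-- `U : [0, ∞) → E` is a strong solution of `U' = AU`, `U(0) = U₀`: it belongs to
`C⁰([0, ∞), D(A)) ∩ C¹([0, ∞), E)`, where `D(A)` has the graph norm, and solves the equation for
every `t ≥ 0`. -/
def IsStrongSolution (A : E →ₗ.[ℂ] E) (U₀ : E) (U : ℝ → E) : Prop :=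
  U 0 = U₀ ∧ ContDiffOn ℝ 1 U (Ici 0) ∧
    ∃ V : ℝ → A.domain, (∀ t, 0 ≤ t → (V t : E) = U t) ∧
      ContinuousOn (fun t => ((V t : E), A (V t))) (Ici 0) ∧
      ∀ t, 0 ≤ t → HasDerivWithinAt U (A (V t)) (Ici 0) t

end Evolution

end Bresse

end

/-!
The proof has an abstract half and a concrete half.

*Abstract half.* Let `A` be m-dissipative on a Hilbert space. Its domain is dense: if `F` is
orthogonal to it and `F = U - A U`, then `‖U‖² ≤ Re ⟪U, F⟫ = 0`. The Yosida approximations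
`A_r = r (r (r - A)⁻¹ - 1)` are bounded, dissipative, commute with each other, and converge to `A`
on the domain. By dissipativity the semigroups `exp (t A_r)` are contractions, and commutation gives
`‖exp (t A_r) x - exp (t A_s) x‖ ≤ t ‖A_r x - A_s x‖`; hence they converge strongly, to the
semigroup of `A` (`IsMDissipative.semigroup`). The limit satisfies Duhamel's formula
`T(t) U - U = ∫₀ᵗ T(s) A U ds` on the domain and commutes with the resolvent; these two facts
identify the generator and yield strong solutions, and weak solutions by density. For uniqueness,
the resolvent maps a weak solution to a strong one, because `D(A*)` contains the range of the
adjoint of the resolvent; the difference of two strong solutions with the same initial value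
vanishes by the energy estimate (`norm_le_of_dissipative`), and the resolvent is injective.

*Concrete half.* Completeness of the energy space needs the energy to control the displacements.
The combinations `w = v¹ ± i v⁵` solve `w' ∓ i l w = (shear - v³) ± i axial`, and a Poincaré
inequality `‖w‖ ≤ 2 L ‖w' - i μ w‖` holds on `H¹₀` for every real `μ` (`poincare`). Dissipativity is
integration by parts. For the range condition, eliminating the velocities from `r U - A U = F`
leaves a Hermitian elliptic system for `(v¹, v³, v⁵)`. Its form is the energy inner product
restricted to the closed subspace of states `(v¹, r v¹, v³, r v³, v⁵, m v⁵)`, where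
`m² = r² + (r / ρ₁) a`, so the solution is an orthogonal projection
(`exists_variational_solution`).
-/

namespace Bresse

/-! ### Dissipative operators, their resolvents and Yosida approximations -/

section Evolution

variable {E : Type*} [NormedAddCommGroup E] [InnerProductSpace ℂ E]

/-- The energy estimate: a curve whose velocity is dissipative has nonincreasing norm. -/
theorem norm_le_of_dissipative {u f : ℝ → E}
    (hu : ∀ t, 0 ≤ t → HasDerivWithinAt u (f t) (Ici 0) t)
    (hf : ∀ t, 0 ≤ t → (⟪u t, f t⟫_ℂ).re ≤ 0) {t : ℝ} (ht : 0 ≤ t) : ‖u t‖ ≤ ‖u 0‖ := by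
  have hd : ∀ t, 0 ≤ t → HasDerivWithinAt (fun s => (⟪u s, u s⟫_ℂ).re)
      (2 * (⟪u t, f t⟫_ℂ).re) (Ici 0) t := by
    intro t ht
    have h1 := (hu t ht).inner ℂ (hu t ht)
    have h2 := (Complex.reCLM.hasFDerivAt (x := ⟪u t, u t⟫_ℂ)).comp_hasDerivWithinAt t h1
    refine h2.congr_deriv ?_
    have h3 : (⟪f t, u t⟫_ℂ).re = (⟪u t, f t⟫_ℂ).re := inner_re_symm (𝕜 := ℂ) _ _
    simp only [Complex.reCLM_apply, Complex.add_re, h3]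
    ring
  have hanti : AntitoneOn (fun s => (⟪u s, u s⟫_ℂ).re) (Ici 0) := by
    refine antitoneOn_of_hasDerivWithinAt_nonpos (convex_Ici 0)
      (fun s hs => (hd s hs).continuousWithinAt)
      (fun s hs => (hd s (interior_subset hs)).mono interior_subset) fun s hs => ?_
    have := hf s (interior_subset hs)
    linarith
  have h := hanti (mem_Ici.2 (le_refl (0 : ℝ))) (mem_Ici.2 ht) ht
  have e : ∀ x : E, (⟪x, x⟫_ℂ).re = ‖x‖ ^ 2 := fun x => inner_self_eq_norm_sq (𝕜 := ℂ) x
  simp only [e] at h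
  exact le_of_sq_le_sq h (norm_nonneg _)

theorem hasDerivWithinAt_integral_Ici {F : Type*} [NormedAddCommGroup F] [NormedSpace ℝ F]
    [CompleteSpace F] {g : ℝ → F} (hg : ContinuousOn g (Ici 0))
    {t : ℝ} (ht : 0 ≤ t) :
    HasDerivWithinAt (fun t => ∫ s in (0 : ℝ)..t, g s) (g t) (Ici 0) t := by
  have hc : Continuous fun s => g (max s 0) :=
    hg.comp_continuous (continuous_id.max continuous_const) fun s => mem_Ici.2 (le_max_right _ _)
  have h := intervalIntegral.integral_hasDerivAt_right (hc.intervalIntegrable 0 t)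
    (hc.stronglyMeasurableAtFilter _ _) hc.continuousAt
  rw [max_eq_left ht] at h
  have e : ∀ s ∈ Ici (0 : ℝ), ∫ r in (0 : ℝ)..s, g r = ∫ r in (0 : ℝ)..s, g (max r 0) := by
    intro s hs
    refine intervalIntegral.integral_congr fun r hr => ?_
    rw [uIcc_of_le hs] at hr
    simp only [max_eq_left hr.1]
  exact h.hasDerivWithinAt.congr e (e t ht)

theorem integral_eq_sub_of_hasDerivWithinAt_Ici {F : Type*} [NormedAddCommGroup F]
    [NormedSpace ℝ F] [CompleteSpace F] {f g : ℝ → F}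
    (hf : ∀ t, 0 ≤ t → HasDerivWithinAt f (g t) (Ici 0) t) (hg : ContinuousOn g (Ici 0))
    {t : ℝ} (ht : 0 ≤ t) : ∫ s in (0 : ℝ)..t, g s = f t - f 0 := by
  refine intervalIntegral.integral_eq_sub_of_hasDerivAt_of_le ht
    (fun s hs => ((hf s hs.1).mono Icc_subset_Ici_self).continuousWithinAt)
    (fun s hs => (hf s hs.1.le).hasDerivAt (Ici_mem_nhds hs.1)) ?_
  refine ContinuousOn.intervalIntegrable (hg.mono ?_)
  rw [uIcc_of_le ht]
  exact Icc_subset_Ici_self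

theorem norm_clm_le_of_le {L : E →L[ℂ] E} (h : ‖L‖ ≤ 1) (x : E) : ‖L x‖ ≤ ‖x‖ :=
  (L.le_of_opNorm_le h x).trans_eq (one_mul _)

/-- Strong convergence of contractions has to be checked on a dense set only. -/
theorem tendsto_of_dense {ι : Type*} {l : Filter ι} {L : ι → E →L[ℂ] E} {L₀ : E →L[ℂ] E}
    (hL : ∀ᶠ i in l, ‖L i‖ ≤ 1) (hL₀ : ‖L₀‖ ≤ 1) {D : Set E} (hD : Dense D)
    (h : ∀ y ∈ D, Tendsto (fun i => L i y) l (𝓝 (L₀ y))) (x : E) :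
    Tendsto (fun i => L i x) l (𝓝 (L₀ x)) := by
  rw [Metric.tendsto_nhds]
  intro ε hε
  obtain ⟨y, hy, hxy⟩ := hD.exists_dist_lt x (show 0 < ε / 3 by positivity)
  filter_upwards [hL, Metric.tendsto_nhds.1 (h y hy) (ε / 3) (by positivity)] with i hi hiy
  have h1 : dist (L i x) (L i y) < ε / 3 := by
    rw [dist_eq_norm, ← map_sub]
    exact (norm_clm_le_of_le hi _).trans_lt (by rwa [← dist_eq_norm])
  have h2 : dist (L₀ y) (L₀ x) < ε / 3 := by
    rw [dist_eq_norm, ← map_sub]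
    exact (norm_clm_le_of_le hL₀ _).trans_lt (by rwa [← dist_eq_norm, dist_comm])
  linarith [dist_triangle4 (L i x) (L i y) (L₀ y) (L₀ x)]

theorem cauchySeq_of_dense {L : ℕ → E →L[ℂ] E} (hL : ∀ n, ‖L n‖ ≤ 1) {D : Set E} (hD : Dense D)
    (h : ∀ y ∈ D, CauchySeq fun n => L n y) (x : E) : CauchySeq fun n => L n x := by
  rw [Metric.cauchySeq_iff]
  intro ε hε
  obtain ⟨y, hy, hxy⟩ := hD.exists_dist_lt x (show 0 < ε / 3 by positivity)
  obtain ⟨N, hN⟩ := Metric.cauchySeq_iff.1 (h y hy) (ε / 3) (by positivity)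
  refine ⟨N, fun m hm n hn => ?_⟩
  have h1 : dist (L m x) (L m y) < ε / 3 := by
    rw [dist_eq_norm, ← map_sub]
    exact (norm_clm_le_of_le (hL m) _).trans_lt (by rwa [← dist_eq_norm])
  have h2 : dist (L n y) (L n x) < ε / 3 := by
    rw [dist_eq_norm, ← map_sub]
    exact (norm_clm_le_of_le (hL n) _).trans_lt (by rwa [← dist_eq_norm, dist_comm])
  linarith [dist_triangle4 (L m x) (L m y) (L n y) (L n x), hN m hm n hn]

section Exp

variable [CompleteSpace E] {B C : E →L[ℂ] E}

theorem hasDerivAt_exp_apply (B : E →L[ℂ] E) (x : E) (t : ℝ) :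
    HasDerivAt (fun s : ℝ => NormedSpace.exp (s • B) x) (NormedSpace.exp (t • B) (B x)) t :=
  ((ContinuousLinearMap.apply ℂ E x).restrictScalars ℝ).hasFDerivAt.comp_hasDerivAt t
    (hasDerivAt_exp_smul_const B t)

theorem norm_exp_le_one (hB : ∀ x, (⟪x, B x⟫_ℂ).re ≤ 0) {t : ℝ} (ht : 0 ≤ t) :
    ‖NormedSpace.exp (t • B)‖ ≤ 1 := by
  refine ContinuousLinearMap.opNorm_le_bound _ zero_le_one fun x => ?_
  have h := norm_le_of_dissipative (u := fun s : ℝ => NormedSpace.exp (s • B) x)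
    (f := fun s => B (NormedSpace.exp (s • B) x)) (fun s _ => ?_) (fun s _ => hB _) ht
  · simpa using h
  · exact (((ContinuousLinearMap.apply ℂ E x).restrictScalars ℝ).hasFDerivAt.comp_hasDerivAt s
      (hasDerivAt_exp_smul_const' B s)).hasDerivWithinAt

theorem norm_exp_sub_exp_le (hB : ∀ x, (⟪x, B x⟫_ℂ).re ≤ 0) (hC : ∀ x, (⟪x, C x⟫_ℂ).re ≤ 0)
    (hBC : Commute B C) {t : ℝ} (ht : 0 ≤ t) (x : E) :
    ‖NormedSpace.exp (t • B) x - NormedSpace.exp (t • C) x‖ ≤ ‖B x - C x‖ * t := by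
  -- Interpolate by `s ↦ exp (s B) exp ((t - s) C) x`, whose velocity is
  -- `exp (s B) exp ((t - s) C) (B x - C x)` because `B` and `C` commute.
  have hd : ∀ s : ℝ, HasDerivAt
      (fun s : ℝ => (NormedSpace.exp (s • B) * NormedSpace.exp ((t - s) • C)) x)
      ((NormedSpace.exp (s • B) * NormedSpace.exp ((t - s) • C)) (B x - C x)) s := by
    intro s
    have h1 := hasDerivAt_exp_smul_const B s
    have h2 : HasDerivAt (fun s : ℝ => NormedSpace.exp ((t - s) • C))
        (-(NormedSpace.exp ((t - s) • C) * C)) s := by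
      have := (hasDerivAt_exp_smul_const C (t - s)).scomp s ((hasDerivAt_id s).const_sub t)
      simpa [Function.comp_def] using this
    have h3 := ((ContinuousLinearMap.apply ℂ E x).restrictScalars ℝ).hasFDerivAt.comp_hasDerivAt s
      (h1.mul h2)
    refine h3.congr_deriv ?_
    have hcomm : B * NormedSpace.exp ((t - s) • C) = NormedSpace.exp ((t - s) • C) * B :=
      ((hBC.symm.smul_left (t - s)).exp_left).symm.eq
    have : NormedSpace.exp (s • B) * B * NormedSpace.exp ((t - s) • C)
        + NormedSpace.exp (s • B) * -(NormedSpace.exp ((t - s) • C) * C)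
        = (NormedSpace.exp (s • B) * NormedSpace.exp ((t - s) • C)) * (B - C) := by
      rw [mul_assoc, hcomm]; noncomm_ring
    rw [this]
    rfl
  have h := norm_image_sub_le_of_norm_deriv_le_segment' (a := 0) (b := t) (C := ‖B x - C x‖)
    (fun s _ => (hd s).hasDerivWithinAt) (fun s hs => ?_) t (right_mem_Icc.2 ht)
  · simpa using h
  · exact (norm_clm_le_of_le (norm_exp_le_one hB hs.1) _).trans
      (norm_clm_le_of_le (norm_exp_le_one hC (sub_nonneg.2 hs.2.le)) _)

end Exp

namespace IsMDissipative

variable {A : E →ₗ.[ℂ] E}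

theorem re_inner_le (h : IsMDissipative A) (r : ℝ) (U : A.domain) :
    r * ‖(U : E)‖ ^ 2 ≤ (⟪(U : E), (r : ℂ) • (U : E) - A U⟫_ℂ).re := by
  have h1 := h.1 U
  have h2 : (⟪(U : E), (U : E)⟫_ℂ) = ((‖(U : E)‖ ^ 2 : ℝ) : ℂ) := by
    rw [inner_self_eq_norm_sq_to_K]; push_cast; rfl
  rw [inner_sub_right, inner_smul_right, h2, ← Complex.ofReal_mul, Complex.sub_re,
    Complex.ofReal_re]
  linarith

theorem mul_norm_le (h : IsMDissipative A) (r : ℝ) (U : A.domain) :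
    r * ‖(U : E)‖ ≤ ‖(r : ℂ) • (U : E) - A U‖ := by
  rcases (norm_nonneg (U : E)).eq_or_lt with h0 | h0
  · rw [← h0, mul_zero]; exact norm_nonneg _
  · refine le_of_mul_le_mul_right ?_ h0
    have h1 := h.re_inner_le r U
    have h2 := re_inner_le_norm (𝕜 := ℂ) (U : E) ((r : ℂ) • (U : E) - A U)
    change (⟪(U : E), (r : ℂ) • (U : E) - A U⟫_ℂ).re ≤ _ at h2
    nlinarith

theorem injective (h : IsMDissipative A) {r : ℝ} (hr : 0 < r) {U V : A.domain}
    (hUV : (r : ℂ) • (U : E) - A U = (r : ℂ) • (V : E) - A V) : U = V := by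
  have h1 := h.mul_norm_le r (U - V)
  rw [LinearPMap.map_sub, Submodule.coe_sub, smul_sub,
    sub_sub_sub_comm, sub_eq_zero.2 hUV, norm_zero] at h1
  have h2 : ‖(U : E) - V‖ = 0 := le_antisymm (by nlinarith) (norm_nonneg _)
  exact Subtype.ext (sub_eq_zero.1 (norm_eq_zero.1 h2))

/-- The resolvent `(r - A)⁻¹`, for `r > 0`, as a linear map onto the domain. -/
noncomputable def resolventLin (h : IsMDissipative A) {r : ℝ} (hr : 0 < r) : E →ₗ[ℂ] A.domain where
  toFun F := (h.2 r hr F).choose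
  map_add' F G := by
    refine h.injective hr ?_
    rw [(h.2 r hr (F + G)).choose_spec, LinearPMap.map_add, Submodule.coe_add, smul_add,
      add_sub_add_comm, (h.2 r hr F).choose_spec, (h.2 r hr G).choose_spec]
  map_smul' c F := by
    refine h.injective hr ?_
    rw [(h.2 r hr (c • F)).choose_spec, RingHom.id_apply, LinearPMap.map_smul, Submodule.coe_smul,
      smul_comm, ← smul_sub, (h.2 r hr F).choose_spec]

theorem resolventLin_spec (h : IsMDissipative A) {r : ℝ} (hr : 0 < r) (F : E) :
    (r : ℂ) • (h.resolventLin hr F : E) - A (h.resolventLin hr F) = F :=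
  (h.2 r hr F).choose_spec

theorem resolventLin_apply (h : IsMDissipative A) {r : ℝ} (hr : 0 < r) (U : A.domain) :
    h.resolventLin hr ((r : ℂ) • (U : E) - A U) = U :=
  h.injective hr (h.resolventLin_spec hr _)

/-- The resolvent `(r - A)⁻¹`, for `r > 0`, as a bounded operator. -/
noncomputable def resolvent (h : IsMDissipative A) {r : ℝ} (hr : 0 < r) : E →L[ℂ] E :=
  LinearMap.mkContinuous (A.domain.subtype ∘ₗ h.resolventLin hr) r⁻¹ fun F => by
    have h1 := h.mul_norm_le r (h.resolventLin hr F)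
    rw [h.resolventLin_spec hr F] at h1
    rw [inv_mul_eq_div, le_div_iff₀ hr, mul_comm]
    exact h1

theorem resolvent_eq (h : IsMDissipative A) {r : ℝ} (hr : 0 < r) (F : E) :
    h.resolvent hr F = (h.resolventLin hr F : E) := rfl

theorem norm_resolvent_le (h : IsMDissipative A) {r : ℝ} (hr : 0 < r) : ‖h.resolvent hr‖ ≤ r⁻¹ :=
  LinearMap.mkContinuous_norm_le _ (by positivity) _

theorem resolvent_apply (h : IsMDissipative A) {r : ℝ} (hr : 0 < r) (U : A.domain) :
    h.resolvent hr ((r : ℂ) • (U : E) - A U) = U := by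
  rw [resolvent_eq, resolventLin_apply]

/-- `R A U = r R U - U` on the domain, for the resolvent `R = (r - A)⁻¹`. -/
theorem resolvent_map (h : IsMDissipative A) {r : ℝ} (hr : 0 < r) (U : A.domain) :
    h.resolvent hr (A U) = (r : ℂ) • h.resolvent hr (U : E) - U := by
  have := h.resolvent_apply hr U
  rw [map_sub, map_smul] at this
  exact (sub_eq_of_eq_add' (sub_eq_iff_eq_add.1 this)).symm

theorem resolvent_injective (h : IsMDissipative A) {r : ℝ} (hr : 0 < r) {F G : E}
    (hFG : h.resolvent hr F = h.resolvent hr G) : F = G := by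
  rw [← h.resolventLin_spec hr F, ← h.resolventLin_spec hr G,
    show h.resolventLin hr F = h.resolventLin hr G from Subtype.ext hFG]

theorem resolvent_identity (h : IsMDissipative A) {r s : ℝ} (hr : 0 < r) (hs : 0 < s) :
    h.resolvent hs = h.resolvent hr + ((r - s : ℝ) : ℂ) • (h.resolvent hr * h.resolvent hs) := by
  ext F
  have h1 := h.resolventLin_spec hs F
  have h2 := h.resolvent_apply hr (h.resolventLin hs F)
  have h3 : (r : ℂ) • (h.resolventLin hs F : E) - A (h.resolventLin hs F)
      = F + ((r - s : ℝ) : ℂ) • h.resolvent hs F := by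
    conv_rhs => rw [← h1, resolvent_eq, h1]
    push_cast
    linear_combination (norm := module) h1
  rw [h3, map_add, map_smul] at h2
  exact h2.symm

theorem commute_resolvent (h : IsMDissipative A) {r s : ℝ} (hr : 0 < r) (hs : 0 < s) :
    Commute (h.resolvent hr) (h.resolvent hs) := by
  rcases eq_or_ne r s with rfl | hne
  · exact Commute.refl _
  · have h1 := h.resolvent_identity hr hs
    have h2 := h.resolvent_identity hs hr
    have hc : ((r - s : ℝ) : ℂ) ≠ 0 := by exact_mod_cast sub_ne_zero.2 hne
    refine smul_right_injective _ hc ?_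
    have h3 : ((s - r : ℝ) : ℂ) = -((r - s : ℝ) : ℂ) := by push_cast; ring
    rw [h3] at h2
    simp only
    linear_combination (norm := module) -h1 - h2

/-- An m-dissipative operator on a Hilbert space is densely defined: if `F` is orthogonal to the
domain and `F = U - A U`, then `‖U‖² ≤ Re ⟪U, F⟫ = 0`. -/
theorem dense_domain [CompleteSpace E] (h : IsMDissipative A) : Dense (A.domain : Set E) := by
  rw [Submodule.dense_iff_topologicalClosure_eq_top, Submodule.topologicalClosure_eq_top_iff,
    Submodule.eq_bot_iff]
  intro F hF
  obtain ⟨U, hU⟩ := h.2 1 one_pos F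
  have h1 := h.re_inner_le 1 U
  rw [hU, hF U U.2, Complex.zero_re, one_mul] at h1
  have h2 : (U : E) = 0 := by
    have : ‖(U : E)‖ ^ 2 = 0 := le_antisymm h1 (sq_nonneg _)
    simpa using this
  have h3 : U = 0 := Subtype.ext h2
  rw [← hU, h3]
  simp

/-- The Yosida approximation `r (r (r - A)⁻¹ - 1)` of `A`. -/
noncomputable def yosida (h : IsMDissipative A) {r : ℝ} (hr : 0 < r) : E →L[ℂ] E :=
  (r : ℂ) • ((r : ℂ) • h.resolvent hr - 1)

theorem norm_smul_resolvent_le (h : IsMDissipative A) {r : ℝ} (hr : 0 < r) :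
    ‖(r : ℂ) • h.resolvent hr‖ ≤ 1 := by
  rw [norm_smul, Complex.norm_real, Real.norm_of_nonneg hr.le]
  calc r * ‖h.resolvent hr‖ ≤ r * r⁻¹ := by gcongr; exact h.norm_resolvent_le hr
    _ = 1 := mul_inv_cancel₀ hr.ne'

theorem yosida_dissipative (h : IsMDissipative A) {r : ℝ} (hr : 0 < r) (x : E) :
    (⟪x, h.yosida hr x⟫_ℂ).re ≤ 0 := by
  have h1 : (⟪x, x⟫_ℂ).re = ‖x‖ ^ 2 := inner_self_eq_norm_sq (𝕜 := ℂ) x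
  have h2 : (⟪x, ((r : ℂ) • h.resolvent hr) x⟫_ℂ).re ≤ ‖x‖ * ‖((r : ℂ) • h.resolvent hr) x‖ :=
    re_inner_le_norm (𝕜 := ℂ) _ _
  have h3 := norm_clm_le_of_le (h.norm_smul_resolvent_le hr) x
  have e : h.yosida hr x = (r : ℂ) • (((r : ℂ) • h.resolvent hr) x - x) := rfl
  rw [e, inner_smul_right, Complex.re_ofReal_mul, inner_sub_right, Complex.sub_re, h1]
  have h4 := mul_le_mul_of_nonneg_left h3 (norm_nonneg x)
  have : (⟪x, ((r : ℂ) • h.resolvent hr) x⟫_ℂ).re - ‖x‖ ^ 2 ≤ 0 := by nlinarith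
  exact mul_nonpos_of_nonneg_of_nonpos hr.le this

theorem yosida_apply (h : IsMDissipative A) {r : ℝ} (hr : 0 < r) (U : A.domain) :
    h.yosida hr (U : E) = ((r : ℂ) • h.resolvent hr) (A U) := by
  have := h.resolvent_map hr U
  change (r : ℂ) • ((r : ℂ) • h.resolvent hr (U : E) - U) = (r : ℂ) • h.resolvent hr (A U)
  rw [this]

theorem norm_yosida_le (h : IsMDissipative A) {r : ℝ} (hr : 0 < r) (U : A.domain) :
    ‖h.yosida hr (U : E)‖ ≤ ‖A U‖ := by
  rw [yosida_apply]
  exact norm_clm_le_of_le (h.norm_smul_resolvent_le hr) _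

theorem commute_resolvent_yosida (h : IsMDissipative A) {r s : ℝ} (hr : 0 < r) (hs : 0 < s) :
    Commute (h.resolvent hr) (h.yosida hs) :=
  (((h.commute_resolvent hr hs).smul_right _).sub_right (Commute.one_right _)).smul_right _

theorem commute_yosida (h : IsMDissipative A) {r s : ℝ} (hr : 0 < r) (hs : 0 < s) :
    Commute (h.yosida hr) (h.yosida hs) :=
  (((h.commute_resolvent_yosida hr hs).smul_left _).sub_left (Commute.one_left _)).smul_left _

end IsMDissipative

/-! ### The generated semigroup and the solutions of the evolution equation -/

theorem IsStrongSolution.isWeakSolution {A : E →ₗ.[ℂ] E} {U₀ : E} {U : ℝ → E}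
    (hU : IsStrongSolution A U₀ U) : IsWeakSolution A U₀ U := by
  obtain ⟨h0, hc, V, hV, -, hd⟩ := hU
  refine ⟨hc.continuousOn, h0, fun X Y hXY t ht => ?_⟩
  have h1 := (hasDerivWithinAt_const t (Ici 0) X).inner ℂ (hd t ht)
  rwa [inner_zero_left, add_zero, ← hXY, hV t ht] at h1

namespace IsMDissipative

variable {A : E →ₗ.[ℂ] E} [CompleteSpace E]

/-- The Yosida approximation with parameter `r = n + 1`. -/
noncomputable def yosidaSeq (h : IsMDissipative A) (n : ℕ) : E →L[ℂ] E :=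
  h.yosida (r := n + 1) n.cast_add_one_pos

/-- The norm continuous semigroup generated by the Yosida approximation `A_{n + 1}`. -/
noncomputable def approx (h : IsMDissipative A) (n : ℕ) (t : ℝ) : E →L[ℂ] E :=
  NormedSpace.exp (t • h.yosidaSeq n)

theorem norm_approx_le (h : IsMDissipative A) (n : ℕ) {t : ℝ} (ht : 0 ≤ t) :
    ‖h.approx n t‖ ≤ 1 :=
  norm_exp_le_one (h.yosida_dissipative _) ht

theorem tendsto_smul_resolvent (h : IsMDissipative A) (x : E) :
    Tendsto (fun n : ℕ => (((n + 1 : ℝ) : ℂ) • h.resolvent (r := n + 1) n.cast_add_one_pos) x)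
      atTop (𝓝 x) := by
  refine tendsto_of_dense (L₀ := ContinuousLinearMap.id ℂ E)
    (Eventually.of_forall fun n => h.norm_smul_resolvent_le _)
    ContinuousLinearMap.norm_id_le h.dense_domain (fun y hy => ?_) x
  rw [tendsto_iff_norm_sub_tendsto_zero]
  have h0 : Tendsto (fun n : ℕ => ((n : ℝ) + 1)⁻¹ * ‖A ⟨y, hy⟩‖) atTop (𝓝 0) := by
    have := (tendsto_one_div_add_atTop_nhds_zero_nat (𝕜 := ℝ)).mul_const ‖A ⟨y, hy⟩‖
    simpa using this
  refine squeeze_zero (fun _ => norm_nonneg _) (fun n => ?_) h0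
  have h1 := h.resolvent_map (r := n + 1) n.cast_add_one_pos ⟨y, hy⟩
  refine le_of_eq_of_le (congrArg norm h1.symm) ?_
  exact ContinuousLinearMap.le_of_opNorm_le _ (h.norm_resolvent_le _) _

theorem tendsto_yosidaSeq (h : IsMDissipative A) (U : A.domain) :
    Tendsto (fun n => h.yosidaSeq n (U : E)) atTop (𝓝 (A U)) := by
  simp only [yosidaSeq, yosida_apply]
  exact h.tendsto_smul_resolvent (A U)

theorem cauchySeq_approx (h : IsMDissipative A) {t : ℝ} (ht : 0 ≤ t) (x : E) :
    CauchySeq fun n => h.approx n t x := by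
  refine cauchySeq_of_dense (fun n => h.norm_approx_le n ht) h.dense_domain (fun y hy => ?_) x
  rw [Metric.cauchySeq_iff]
  intro ε hε
  obtain ⟨N, hN⟩ := Metric.cauchySeq_iff.1 (h.tendsto_yosidaSeq ⟨y, hy⟩).cauchySeq
    (ε / (t + 1)) (by positivity)
  refine ⟨N, fun m hm n hn => ?_⟩
  have h1 := norm_exp_sub_exp_le (h.yosida_dissipative m.cast_add_one_pos)
    (h.yosida_dissipative n.cast_add_one_pos)
    (h.commute_yosida m.cast_add_one_pos n.cast_add_one_pos) ht y
  have h2 : ‖h.yosidaSeq m y - h.yosidaSeq n y‖ < ε / (t + 1) := by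
    rw [← dist_eq_norm]; exact hN m hm n hn
  rw [dist_eq_norm]
  refine h1.trans_lt ?_
  have h3 : ε / (t + 1) * (t + 1) = ε := by field_simp
  change ‖h.yosidaSeq m y - h.yosidaSeq n y‖ * t < ε
  nlinarith [norm_nonneg (h.yosidaSeq m y - h.yosidaSeq n y),
    show 0 < ε / (t + 1) by positivity]

theorem exists_tendsto_approx (h : IsMDissipative A) (t : ℝ) :
    ∃ T : E →L[ℂ] E, ∀ x, Tendsto (fun n => h.approx n (max t 0) x) atTop (𝓝 (T x)) := by
  choose f hf using fun x =>
    cauchySeq_tendsto_of_complete (h.cauchySeq_approx (le_max_right t 0) x)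
  exact ⟨continuousLinearMapOfTendsto (fun n => h.approx n (max t 0)) (tendsto_pi_nhds.2 hf), hf⟩

/-- The contraction semigroup generated by an m-dissipative operator, the strong limit of the
semigroups generated by its Yosida approximations; its value is the identity at negative times. -/
noncomputable def semigroup (h : IsMDissipative A) (t : ℝ) : E →L[ℂ] E :=
  (h.exists_tendsto_approx t).choose

theorem tendsto_approx (h : IsMDissipative A) {t : ℝ} (ht : 0 ≤ t) (x : E) :
    Tendsto (fun n => h.approx n t x) atTop (𝓝 (h.semigroup t x)) := by
  have h1 : Tendsto (fun n => h.approx n (max t 0) x) atTop (𝓝 (h.semigroup t x)) :=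
    (h.exists_tendsto_approx t).choose_spec x
  rwa [max_eq_left ht] at h1

@[simp]
theorem semigroup_zero_apply (h : IsMDissipative A) (x : E) : h.semigroup 0 x = x :=
  tendsto_nhds_unique (h.tendsto_approx le_rfl x) (by simp [approx])

theorem norm_semigroup_le (h : IsMDissipative A) {t : ℝ} (ht : 0 ≤ t) : ‖h.semigroup t‖ ≤ 1 := by
  refine ContinuousLinearMap.opNorm_le_bound _ zero_le_one fun x => ?_
  rw [one_mul]
  exact le_of_tendsto (h.tendsto_approx ht x).norm
    (Eventually.of_forall fun n => norm_clm_le_of_le (h.norm_approx_le n ht) x)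

theorem norm_approx_sub_le (h : IsMDissipative A) (n : ℕ) (U : A.domain) {s t : ℝ} (hs : 0 ≤ s)
    (ht : 0 ≤ t) : ‖h.approx n t (U : E) - h.approx n s (U : E)‖ ≤ ‖A U‖ * ‖t - s‖ := by
  refine (convex_Ici (0 : ℝ)).norm_image_sub_le_of_norm_hasDerivWithin_le
    (f' := fun r => h.approx n r (h.yosidaSeq n U))
    (fun r _ => (hasDerivAt_exp_apply _ _ r).hasDerivWithinAt) (fun r hr => ?_) hs ht
  exact (norm_clm_le_of_le (h.norm_approx_le n hr) _).trans (h.norm_yosida_le _ U)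

theorem norm_semigroup_sub_le (h : IsMDissipative A) (U : A.domain) {s t : ℝ} (hs : 0 ≤ s)
    (ht : 0 ≤ t) : ‖h.semigroup t (U : E) - h.semigroup s (U : E)‖ ≤ ‖A U‖ * ‖t - s‖ :=
  le_of_tendsto ((h.tendsto_approx ht _).sub (h.tendsto_approx hs _)).norm
    (Eventually.of_forall fun n => h.norm_approx_sub_le n U hs ht)

theorem continuousOn_semigroup (h : IsMDissipative A) (x : E) :
    ContinuousOn (fun t => h.semigroup t x) (Ici 0) := by
  intro t ht
  refine tendsto_of_dense (l := 𝓝[Ici 0] t) (L := h.semigroup) (L₀ := h.semigroup t)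
    (eventually_nhdsWithin_of_forall fun s hs => h.norm_semigroup_le hs)
    (h.norm_semigroup_le ht) h.dense_domain (fun y hy => ?_) x
  rw [tendsto_iff_norm_sub_tendsto_zero]
  have h0 : Tendsto (fun s : ℝ => ‖A ⟨y, hy⟩‖ * ‖s - t‖) (𝓝[Ici 0] t) (𝓝 0) := by
    have : Continuous fun s : ℝ => ‖A ⟨y, hy⟩‖ * ‖s - t‖ := by fun_prop
    have := this.tendsto t
    simp only [sub_self, norm_zero, mul_zero] at this
    exact this.mono_left nhdsWithin_le_nhds
  refine squeeze_zero' (Eventually.of_forall fun _ => norm_nonneg _) ?_ h0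
  exact eventually_nhdsWithin_of_forall fun s hs => h.norm_semigroup_sub_le ⟨y, hy⟩ ht hs

theorem isC0ContractionSemigroup (h : IsMDissipative A) :
    IsC0ContractionSemigroup h.semigroup where
  zero := ContinuousLinearMap.ext h.semigroup_zero_apply
  add s t hs ht := by
    ext x
    refine tendsto_nhds_unique (h.tendsto_approx (add_nonneg hs ht) x) ?_
    have e : ∀ n, h.approx n (s + t) x = h.approx n s (h.approx n t x) := fun n => by
      let _ : NormedAlgebra ℚ (E →L[ℂ] E) := NormedAlgebra.restrictScalars ℚ ℂ _
      have := NormedSpace.exp_add_of_commute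
        (((Commute.refl (h.yosidaSeq n)).smul_left s).smul_right t)
      rw [approx, add_smul, this]
      rfl
    simp only [e]
    have h1 : Tendsto (fun n => h.approx n s (h.approx n t x - h.semigroup t x)) atTop (𝓝 0) := by
      refine squeeze_zero_norm (fun n => norm_clm_le_of_le (h.norm_approx_le n hs) _) ?_
      exact tendsto_iff_norm_sub_tendsto_zero.1 (h.tendsto_approx ht x)
    have h2 := h1.add (h.tendsto_approx hs (h.semigroup t x))
    simpa using h2
  continuousOn := h.continuousOn_semigroup
  contraction t ht := h.norm_semigroup_le ht

theorem semigroup_resolvent (h : IsMDissipative A) {r : ℝ} (hr : 0 < r) {t : ℝ} (ht : 0 ≤ t)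
    (x : E) : h.semigroup t (h.resolvent hr x) = h.resolvent hr (h.semigroup t x) := by
  refine tendsto_nhds_unique (h.tendsto_approx ht _) ?_
  have h1 := ((h.resolvent hr).continuous.tendsto _).comp (h.tendsto_approx ht x)
  refine h1.congr fun n => ?_
  have h2 := ((h.commute_resolvent_yosida hr n.cast_add_one_pos).smul_right t).exp_right.eq
  exact congrArg (fun L : E →L[ℂ] E => L x) h2

/-- Duhamel's formula `T(t) U - U = ∫₀ᵗ T(s) A U ds` on the domain. -/
theorem integral_semigroup (h : IsMDissipative A) (U : A.domain) {t : ℝ} (ht : 0 ≤ t) :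
    ∫ s in (0 : ℝ)..t, h.semigroup s (A U) = h.semigroup t (U : E) - U := by
  have hc : ∀ (n : ℕ) (y : E), Continuous fun s => h.approx n s y := fun n y =>
    continuous_iff_continuousAt.2 fun s => (hasDerivAt_exp_apply _ _ s).continuousAt
  have e : ∀ n, ∫ s in (0 : ℝ)..t, h.approx n s (h.yosidaSeq n U)
      = h.approx n t (U : E) - U := by
    intro n
    refine (intervalIntegral.integral_eq_sub_of_hasDerivAt
      (fun s _ => hasDerivAt_exp_apply (h.yosidaSeq n) (U : E) s)
      ((hc n _).intervalIntegrable _ _)).trans ?_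
    simp [approx]
  refine tendsto_nhds_unique ?_ ((h.tendsto_approx ht (U : E)).sub_const (U : E))
  simp only [← e]
  refine intervalIntegral.tendsto_integral_filter_of_dominated_convergence (fun _ => ‖A U‖)
    (Eventually.of_forall fun n => (hc n _).aestronglyMeasurable) ?_ (by simp) ?_
  · refine Eventually.of_forall fun n => Eventually.of_forall fun s hs => ?_
    rw [uIoc_of_le ht] at hs
    exact (norm_clm_le_of_le (h.norm_approx_le n hs.1.le) _).trans (h.norm_yosida_le _ U)
  · refine Eventually.of_forall fun s hs => ?_
    rw [uIoc_of_le ht] at hs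
    have h1 : Tendsto (fun n => h.approx n s (h.yosidaSeq n (U : E) - A U)) atTop (𝓝 0) := by
      refine squeeze_zero_norm (fun n => norm_clm_le_of_le (h.norm_approx_le n hs.1.le) _) ?_
      exact tendsto_iff_norm_sub_tendsto_zero.1 (h.tendsto_yosidaSeq U)
    have h2 := h1.add (h.tendsto_approx hs.1.le (A U))
    simpa using h2

theorem hasDerivWithinAt_semigroup (h : IsMDissipative A) (U : A.domain) {t : ℝ} (ht : 0 ≤ t) :
    HasDerivWithinAt (fun s => h.semigroup s (U : E)) (h.semigroup t (A U)) (Ici 0) t := by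
  have h1 := (hasDerivWithinAt_integral_Ici (h.continuousOn_semigroup (A U)) ht).add_const (U : E)
  refine h1.congr (fun s hs => ?_) ?_
  · rw [h.integral_semigroup U hs]; abel
  · rw [h.integral_semigroup U ht]; abel

/-- The semigroup leaves the domain invariant and commutes with the operator. -/
theorem exists_map_semigroup (h : IsMDissipative A) (U : A.domain) {t : ℝ} (ht : 0 ≤ t) :
    ∃ V : A.domain, (V : E) = h.semigroup t (U : E) ∧ A V = h.semigroup t (A U) := by
  have e : h.semigroup t (U : E) = h.resolventLin one_pos
      (h.semigroup t ((1 : ℝ) • (U : E) - A U)) := by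
    rw [← resolvent_eq, ← h.semigroup_resolvent one_pos ht]
    congr 1
    exact_mod_cast (h.resolvent_apply one_pos U).symm
  refine ⟨_, e.symm, ?_⟩
  have h1 := h.resolventLin_spec one_pos (h.semigroup t ((1 : ℝ) • (U : E) - A U))
  rw [← e, map_sub, Complex.ofReal_one, one_smul, one_smul] at h1
  rw [one_smul, map_sub]
  exact (sub_right_inj.1 h1)

theorem isGenerator_semigroup (h : IsMDissipative A) : IsGenerator A h.semigroup := by
  have key : ∀ U : A.domain, Tendsto
      (fun t : ℝ => (t : ℂ)⁻¹ • (h.semigroup t (U : E) - U)) (𝓝[>] 0) (𝓝 (A U)) := by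
    intro U
    have h1 := (h.hasDerivWithinAt_semigroup U le_rfl).mono (Ioi_subset_Ici_self)
    rw [hasDerivWithinAt_iff_tendsto_slope' (by simp), semigroup_zero_apply] at h1
    refine h1.congr fun t => ?_
    rw [slope_def_module, sub_zero, semigroup_zero_apply, ← Complex.ofReal_inv,
      Complex.coe_smul]
  intro U F
  rw [LinearPMap.mem_graph_iff]
  refine ⟨?_, fun hF => ?_⟩
  · rintro ⟨V, hV, hF⟩
    simp only at hV hF
    rw [← hV, ← hF]
    exact key V
  -- Apply the resolvent `R = (1 - A)⁻¹` to the difference quotient: it commutes with the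
  -- semigroup, and `R U` lies in the domain, so that `R F = A R U = R U - U`.
  · have h1 := ((h.resolvent one_pos).continuous.tendsto F).comp hF
    have h2 : Tendsto (fun t : ℝ => (t : ℂ)⁻¹ • (h.semigroup t (h.resolventLin one_pos U : E)
        - h.resolventLin one_pos U)) (𝓝[>] 0) (𝓝 (h.resolvent one_pos F)) := by
      refine h1.congr' (eventually_nhdsWithin_of_forall fun t ht => ?_)
      simp only [Function.comp_apply]
      rw [← resolvent_eq, h.semigroup_resolvent one_pos (le_of_lt ht), ← map_sub, ← map_smul]
    have h3 := tendsto_nhds_unique h2 (key _)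
    have h4 := h.resolventLin_spec one_pos U
    rw [Complex.ofReal_one, one_smul, ← h3, ← resolvent_eq, ← map_sub] at h4
    have h5 := h.resolventLin_spec one_pos (U - F)
    have h6 : (h.resolventLin one_pos (U - F) : E) = U := h4
    refine ⟨_, h6, ?_⟩
    rw [h6, Complex.ofReal_one, one_smul] at h5
    exact sub_right_inj.1 h5

theorem isStrongSolution_semigroup (h : IsMDissipative A) {U₀ : E} (hU₀ : U₀ ∈ A.domain) :
    IsStrongSolution A U₀ fun t => h.semigroup t U₀ := by
  have hd : ∀ t, 0 ≤ t → HasDerivWithinAt (fun s => h.semigroup s U₀)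
      (h.semigroup t (A ⟨U₀, hU₀⟩)) (Ici 0) t :=
    fun t ht => h.hasDerivWithinAt_semigroup ⟨U₀, hU₀⟩ ht
  have hV : ∀ t, ∃ V : A.domain, 0 ≤ t → (V : E) = h.semigroup t U₀ ∧
      A V = h.semigroup t (A ⟨U₀, hU₀⟩) := by
    intro t
    by_cases ht : 0 ≤ t
    · obtain ⟨V, hV⟩ := h.exists_map_semigroup ⟨U₀, hU₀⟩ ht
      exact ⟨V, fun _ => hV⟩
    · exact ⟨0, fun h => absurd h ht⟩
  choose V hV using hV
  refine ⟨h.semigroup_zero_apply U₀, ?_, V, fun t ht => (hV t ht).1, ?_, ?_⟩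
  · rw [contDiffOn_one_iff_derivWithin (uniqueDiffOn_Ici 0)]
    refine ⟨fun t ht => (hd t ht).differentiableWithinAt, ?_⟩
    refine (h.continuousOn_semigroup (A ⟨U₀, hU₀⟩)).congr fun t ht => ?_
    exact (hd t ht).derivWithin (uniqueDiffOn_Ici 0 t ht)
  · refine ((h.continuousOn_semigroup U₀).prodMk
      (h.continuousOn_semigroup (A ⟨U₀, hU₀⟩))).congr fun t ht => ?_
    rw [(hV t ht).1, (hV t ht).2]
  · intro t ht
    rw [(hV t ht).2]
    exact hd t ht

/-- Weak solutions are limits of strong ones: the integrated equation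
`⟪V, T(t) U₀⟫ - ⟪V, U₀⟫ = ∫₀ᵗ ⟪A* V, T(s) U₀⟫ ds` passes from the domain to its closure. -/
theorem isWeakSolution_semigroup (h : IsMDissipative A) (U₀ : E) :
    IsWeakSolution A U₀ fun t => h.semigroup t U₀ := by
  refine ⟨h.continuousOn_semigroup U₀, h.semigroup_zero_apply U₀,
    fun V W hVW t ht => ?_⟩
  have hcont : ∀ x, ContinuousOn (fun s => ⟪W, h.semigroup s x⟫_ℂ) (Ici 0) := fun x =>
    continuousOn_const.inner (h.continuousOn_semigroup x)
  have hii : ∀ (x : E) (s : ℝ), 0 ≤ s →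
      IntervalIntegrable (fun r => h.semigroup r x) volume 0 s := by
    intro x s hs
    refine ((h.continuousOn_semigroup x).mono ?_).intervalIntegrable
    rw [uIcc_of_le hs]
    exact Icc_subset_Ici_self
  have hint : ∀ s, 0 ≤ s → ∫ r in (0 : ℝ)..s, ⟪W, h.semigroup r U₀⟫_ℂ
      = ⟪V, h.semigroup s U₀⟫_ℂ - ⟪V, U₀⟫_ℂ := by
    intro s hs
    have e : ∀ x, ∫ r in (0 : ℝ)..s, ⟪W, h.semigroup r x⟫_ℂ
        = ⟪W, ∫ r in (0 : ℝ)..s, h.semigroup r x⟫_ℂ := fun x =>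
      (innerSL ℂ W).intervalIntegral_comp_comm (hii x s hs)
    have hlip : ∀ x y, ‖(∫ r in (0 : ℝ)..s, h.semigroup r x) - ∫ r in (0 : ℝ)..s, h.semigroup r y‖
        ≤ s * ‖x - y‖ := by
      intro x y
      rw [← intervalIntegral.integral_sub (hii x s hs) (hii y s hs)]
      have := intervalIntegral.norm_integral_le_of_norm_le_const (a := 0) (b := s)
        (f := fun r => h.semigroup r x - h.semigroup r y) (C := ‖x - y‖) fun r hr => by
          rw [uIoc_of_le hs] at hr
          rw [← map_sub]
          exact norm_clm_le_of_le (h.norm_semigroup_le hr.1.le) _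
      rwa [sub_zero, abs_of_nonneg hs, mul_comm] at this
    have hcx : Continuous fun x => ∫ r in (0 : ℝ)..s, h.semigroup r x :=
      (LipschitzWith.of_dist_le_mul (K := ⟨s, hs⟩) fun x y => by
        rw [dist_eq_norm, dist_eq_norm]; exact hlip x y).continuous
    have heq : (fun x => ⟪W, ∫ r in (0 : ℝ)..s, h.semigroup r x⟫_ℂ)
        = fun x => ⟪V, h.semigroup s x⟫_ℂ - ⟪V, x⟫_ℂ := by
      refine Continuous.ext_on h.dense_domain (continuous_const.inner hcx)
        ((continuous_const.inner (h.semigroup s).continuous).sub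
          (continuous_const.inner continuous_id)) fun x hx => ?_
      have h1 := ((h.isStrongSolution_semigroup hx).isWeakSolution).2.2 V W hVW
      have h2 := integral_eq_sub_of_hasDerivWithinAt_Ici h1 (hcont x) hs
      simp only [semigroup_zero_apply] at h2
      rw [← e, h2]
    rw [e]
    exact congrFun heq U₀
  have h1 := (hasDerivWithinAt_integral_Ici (hcont U₀) ht).add_const ⟪V, U₀⟫_ℂ
  refine h1.congr (fun s hs => ?_) ?_
  · rw [hint s hs]; ring
  · rw [hint t ht]; ring

/-- The resolvent turns a weak solution `U` into the strong solution `R U`: testing with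
`V = R* y`, for which `A* V = R* y - y`, shows that `R U` has the weak, hence the strong, derivative
`R U - U = A R U`. -/
theorem hasDerivWithinAt_resolvent (h : IsMDissipative A) {U₀ : E} {U : ℝ → E}
    (hU : IsWeakSolution A U₀ U) {t : ℝ} (ht : 0 ≤ t) :
    HasDerivWithinAt (fun s => h.resolvent one_pos (U s)) (h.resolvent one_pos (U t) - U t)
      (Ici 0) t := by
  obtain ⟨hc, h0, hw⟩ := hU
  have hcR : ContinuousOn (fun s => h.resolvent one_pos (U s) - U s) (Ici 0) :=
    ((h.resolvent one_pos).continuous.comp_continuousOn hc).sub hc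
  have hint : ∀ s, 0 ≤ s → ∫ r in (0 : ℝ)..s, (h.resolvent one_pos (U r) - U r)
      = h.resolvent one_pos (U s) - h.resolvent one_pos (U 0) := by
    intro s hs
    refine ext_inner_left ℂ fun y => ?_
    have hy : ∀ X : A.domain, ⟪(h.resolvent one_pos).adjoint y - y, (X : E)⟫_ℂ
        = ⟪(h.resolvent one_pos).adjoint y, A X⟫_ℂ := by
      intro X
      rw [inner_sub_left, ContinuousLinearMap.adjoint_inner_left,
        ContinuousLinearMap.adjoint_inner_left, h.resolvent_map, inner_sub_right,
        Complex.ofReal_one, one_smul]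
    have h1 : ∀ t, 0 ≤ t → HasDerivWithinAt (fun s => ⟪y, h.resolvent one_pos (U s)⟫_ℂ)
        ⟪y, h.resolvent one_pos (U t) - U t⟫_ℂ (Ici 0) t := by
      intro t ht
      have := hw _ _ hy t ht
      simpa only [inner_sub_left, inner_sub_right, ContinuousLinearMap.adjoint_inner_left]
        using this
    have h2 := integral_eq_sub_of_hasDerivWithinAt_Ici h1 (continuousOn_const.inner hcR) hs
    rw [inner_sub_right, ← h2]
    refine ((innerSL ℂ y).intervalIntegral_comp_comm ?_).symm
    refine (hcR.mono ?_).intervalIntegrable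
    rw [uIcc_of_le hs]
    exact Icc_subset_Ici_self
  have h1 := (hasDerivWithinAt_integral_Ici hcR ht).add_const (h.resolvent one_pos (U 0))
  refine h1.congr (fun s hs => ?_) ?_
  · rw [hint s hs]; abel
  · rw [hint t ht]; abel

theorem weakSolution_unique (h : IsMDissipative A) {U₀ : E} {U V : ℝ → E}
    (hU : IsWeakSolution A U₀ U) (hV : IsWeakSolution A U₀ V) {t : ℝ} (ht : 0 ≤ t) :
    U t = V t := by
  refine h.resolvent_injective one_pos (sub_eq_zero.1 ?_)
  have h1 := norm_le_of_dissipative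
    (u := fun s => h.resolvent one_pos (U s) - h.resolvent one_pos (V s))
    (f := fun s => A (h.resolventLin one_pos (U s) - h.resolventLin one_pos (V s)))
    (fun s hs => ?_) (fun s _ => ?_) ht
  · rw [hU.2.1, hV.2.1, sub_self, norm_zero] at h1
    exact norm_le_zero_iff.1 h1
  · refine ((h.hasDerivWithinAt_resolvent hU hs).sub
      (h.hasDerivWithinAt_resolvent hV hs)).congr_deriv ?_
    have e : ∀ x, A (h.resolventLin one_pos x) = h.resolvent one_pos x - x := fun x => by
      have := h.resolventLin_spec one_pos x
      rw [Complex.ofReal_one, one_smul] at this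
      rw [resolvent_eq]
      exact (sub_eq_of_eq_add' (sub_eq_iff_eq_add.1 this)).symm
    rw [LinearPMap.map_sub, e, e]
  · exact h.1 (h.resolventLin one_pos (U s) - h.resolventLin one_pos (V s))

end IsMDissipative

end Evolution

/-! ### Integration by parts and the Poincaré inequality -/

/-- The pointwise complex conjugate of a test function. -/
noncomputable def TestFn.conj {L : ℝ} (φ : TestFn L) : TestFn L :=
  ⟨fun x => (starRingEnd ℂ) (φ x), Complex.conjCLE.contDiff.comp φ.contDiff,
    φ.hasCompactSupport.comp_left (g := starRingEnd ℂ) (map_zero _),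
    (tsupport_comp_subset (g := starRingEnd ℂ) (map_zero _) φ).trans φ.tsupport_subset⟩

theorem TestFn.conj_apply {L : ℝ} (φ : TestFn L) (x : ℝ) :
    φ.conj x = (starRingEnd ℂ) (φ x) := rfl

theorem TestFn.deriv_conj {L : ℝ} (φ : TestFn L) (x : ℝ) :
    deriv φ.conj x = (starRingEnd ℂ) (deriv φ x) :=
  deriv.star (f := φ) (x := x)

theorem exists_H10_of_mem_closure {L : ℝ} {p : L2 L × L2 L}
    (hp : p ∈ (testGraph L).topologicalClosure) : ∃ w : H10 L, (w : L2 L) = p.1 ∧ dx w = p.2 :=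
  ⟨⟨_, Submodule.mem_map_of_mem hp⟩, rfl, weakDeriv_eq _ (closure_le_weakGraph L hp)⟩

/-- The class in `L²` of a test function is in `H¹₀`, with the classical derivative. -/
theorem exists_H10_testFn {L : ℝ} (φ : TestFn L) :
    ∃ w : H10 L, (w : L2 L) = (memLp_of_continuous L φ.continuous).toLp _ ∧
      dx w = (memLp_of_continuous L φ.continuous_deriv).toLp _ :=
  exists_H10_of_mem_closure (p := ((memLp_of_continuous L φ.continuous).toLp _,
    (memLp_of_continuous L φ.continuous_deriv).toLp _)) ((testGraph L).le_topologicalClosure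
    ⟨φ, (memLp_of_continuous L φ.continuous).coeFn_toLp,
      (memLp_of_continuous L φ.continuous_deriv).coeFn_toLp⟩)

/-- The derivative is a closed operator on `H¹₀`. -/
theorem exists_H10_of_tendsto {L : ℝ} {u : ℕ → H10 L} {v g : L2 L}
    (hv : Tendsto (fun n => (u n : L2 L)) atTop (𝓝 v))
    (hg : Tendsto (fun n => dx (u n)) atTop (𝓝 g)) : ∃ w : H10 L, (w : L2 L) = v ∧ dx w = g :=
  exists_H10_of_mem_closure (p := (v, g))
    ((testGraph L).isClosed_topologicalClosure.mem_of_tendsto (hv.prodMk_nhds hg)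
      (Eventually.of_forall fun n => mem_closure_testGraph (u n)))

/-- A property of `(w, w')` that is closed in `L² × L²` has to be checked on test functions only. -/
theorem H10_induction {L : ℝ} {P : L2 L × L2 L → Prop} (hP : IsClosed {p | P p})
    (h : ∀ φ : TestFn L, P ((memLp_of_continuous L φ.continuous).toLp _,
      (memLp_of_continuous L φ.continuous_deriv).toLp _)) (w : H10 L) : P (w, dx w) := by
  refine hP.closure_subset_iff.2 ?_ (mem_closure_testGraph w)
  rintro ⟨p, q⟩ ⟨φ, h1, h2⟩
  have e1 : p = (memLp_of_continuous L φ.continuous).toLp _ :=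
    Lp.ext (h1.trans (MemLp.coeFn_toLp _).symm)
  have e2 : q = (memLp_of_continuous L φ.continuous_deriv).toLp _ :=
    Lp.ext (h2.trans (MemLp.coeFn_toLp _).symm)
  rw [e1, e2]
  exact h φ

theorem integral_mul_conj_testFn {L : ℝ} (φ : TestFn L) (u : L2 L) :
    ∫ x in Ioo 0 L, u x * φ.conj x
      = ⟪(memLp_of_continuous L φ.continuous).toLp _, u⟫_ℂ := by
  rw [integral_eq_inner L u φ.conj.continuous]
  congr 2
  ext x
  simp [TestFn.conj_apply]

theorem integral_mul_deriv_conj_testFn {L : ℝ} (φ : TestFn L) (u : L2 L) :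
    ∫ x in Ioo 0 L, u x * deriv φ.conj x
      = ⟪(memLp_of_continuous L φ.continuous_deriv).toLp _, u⟫_ℂ := by
  rw [integral_eq_inner L u φ.conj.continuous_deriv]
  congr 2
  ext x
  simp [TestFn.deriv_conj]

/-- The weak derivative is characterised by integration by parts against `H¹₀`. -/
theorem isWeakDeriv_iff_inner {L : ℝ} {u g : L2 L} :
    IsWeakDeriv L u g ↔ ∀ w : H10 L, ⟪dx w, u⟫_ℂ = -⟪(w : L2 L), g⟫_ℂ := by
  refine ⟨fun h w => ?_, fun h φ => ?_⟩
  · refine H10_induction (P := fun p => ⟪p.2, u⟫_ℂ = -⟪p.1, g⟫_ℂ) ?_ (fun φ => ?_) w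
    · exact isClosed_eq (continuous_snd.inner continuous_const)
        (continuous_fst.inner continuous_const).neg
    · have := h φ.conj
      rwa [integral_mul_deriv_conj_testFn, integral_mul_conj_testFn] at this
  · obtain ⟨w, h1, h2⟩ := exists_H10_testFn φ.conj
    have h3 := h w
    rw [h1, h2, ← integral_mul_deriv_conj_testFn, ← integral_mul_conj_testFn] at h3
    have e : φ.conj.conj = φ := by
      ext x
      simp [TestFn.conj_apply]
    rwa [e] at h3

theorem mem_H1_of_isWeakDeriv {L : ℝ} {u g : L2 L} (h : IsWeakDeriv L u g) : u ∈ H1 L :=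
  ⟨(u, g), h, rfl⟩

theorem inner_dx {L : ℝ} (w : H10 L) (u : H1 L) :
    ⟪dx w, (u : L2 L)⟫_ℂ = -⟪(w : L2 L), weakDeriv L u⟫_ℂ :=
  isWeakDeriv_iff_inner.1 (isWeakDeriv_weakDeriv u) w

/-- The Poincaré inequality for the gauge transformed derivative `w' - i μ w`. The proof is the
identity `‖w‖² = ∫ |w|² = -∫ x (|w|²)' = -2 Re ⟪x w, w'⟫ = -2 Re ⟪x w, w' - i μ w⟫`. -/
theorem poincare {L : ℝ} (hL : 0 < L) (μ : ℝ) (w : H10 L) :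
    ‖(w : L2 L)‖ ≤ 2 * L * ‖dx w - (Complex.I * μ) • (w : L2 L)‖ := by
  refine H10_induction
    (P := fun p => ‖p.1‖ ≤ 2 * L * ‖p.2 - (Complex.I * μ) • p.1‖) ?_ (fun φ => ?_) w
  · exact isClosed_le (by fun_prop) (by fun_prop)
  have c0 := φ.continuous
  have c1 := φ.continuous_deriv
  have cy : Continuous fun x : ℝ => (x : ℂ) * φ x := by fun_prop
  have cz : Continuous fun x : ℝ => (x : ℂ) * deriv φ x := by fun_prop
  set q := (memLp_of_continuous L c0).toLp _ with hq
  set q' := (memLp_of_continuous L c1).toLp _ with hq'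
  set y := (memLp_of_continuous L cy).toLp _ with hy
  set z := (memLp_of_continuous L cz).toLp _ with hz
  have aq : q =ᵐ[volume.restrict (Ioo 0 L)] φ := MemLp.coeFn_toLp _
  have aq' : q' =ᵐ[volume.restrict (Ioo 0 L)] deriv φ := MemLp.coeFn_toLp _
  have ay : y =ᵐ[volume.restrict (Ioo 0 L)] fun x => (x : ℂ) * φ x := MemLp.coeFn_toLp _
  have az : z =ᵐ[volume.restrict (Ioo 0 L)] fun x => (x : ℂ) * deriv φ x := MemLp.coeFn_toLp _
  have hyq : ⟪y, q⟫_ℂ = ⟪q, y⟫_ℂ := by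
    rw [L2.inner_def, L2.inner_def]
    refine integral_congr_ae ?_
    filter_upwards [aq, ay] with x h1 h2
    simp only [h1, h2, RCLike.inner_apply, map_mul, Complex.conj_ofReal]
    ring
  have hzq : ⟪z, q⟫_ℂ = ⟪q', y⟫_ℂ := by
    rw [L2.inner_def, L2.inner_def]
    refine integral_congr_ae ?_
    filter_upwards [aq, aq', ay, az] with x h1 h2 h3 h4
    simp only [h1, h2, h3, h4, RCLike.inner_apply, map_mul, Complex.conj_ofReal]
    ring
  have hparts : ⟪q, q⟫_ℂ + ⟪z, q⟫_ℂ = -⟪y, q'⟫_ℂ := by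
    have hd : ∀ x : ℝ, HasDerivAt (fun x : ℝ => (x : ℂ) * φ.conj x)
        (φ.conj x + (x : ℂ) * deriv φ.conj x) x := by
      intro x
      have h1 := (Complex.ofRealCLM.hasDerivAt (x := x)).mul
        ((φ.conj.contDiff.differentiable (by simp) x).hasDerivAt)
      refine h1.congr_deriv ?_
      simp
    have c2 := φ.conj.continuous
    have c3 := φ.conj.continuous_deriv
    have h := closure_integral_by_parts (p := (q, q'))
      ((testGraph L).le_topologicalClosure ⟨φ, aq, aq'⟩) hd (by fun_prop)
    rw [integral_eq_inner L _ (by fun_prop), integral_eq_inner L _ (by fun_prop)] at h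
    have e1 : q + z = (memLp_of_continuous L (Complex.continuous_conj.comp
        (show Continuous fun x : ℝ => φ.conj x + (x : ℂ) * deriv φ.conj x by fun_prop))).toLp _ := by
      rw [hq, hz, ← MemLp.toLp_add]
      refine MemLp.toLp_congr _ _ (Eventually.of_forall fun x => ?_)
      simp [TestFn.conj_apply, TestFn.deriv_conj]
    have e2 : y = (memLp_of_continuous L (Complex.continuous_conj.comp
        (show Continuous fun x : ℝ => (x : ℂ) * φ.conj x by fun_prop))).toLp _ := by
      refine MemLp.toLp_congr _ _ (Eventually.of_forall fun x => ?_)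
      simp [TestFn.conj_apply]
    rwa [← e1, ← e2, inner_add_left] at h
  have hny : ‖y‖ ≤ L * ‖q‖ := by
    refine Lp.norm_le_mul_norm_of_ae_le_mul ?_
    filter_upwards [aq, ay, ae_restrict_mem measurableSet_Ioo] with x h1 h2 hx
    rw [h1, h2, norm_mul, Complex.norm_real, Real.norm_of_nonneg hx.1.le]
    exact mul_le_mul_of_nonneg_right hx.2.le (norm_nonneg _)
  have him : (⟪y, q⟫_ℂ).im = 0 :=
    Complex.conj_eq_iff_im.1 (by rw [inner_conj_symm]; exact hyq.symm)
  have hre : ‖q‖ ^ 2 = -2 * (⟪y, q' - (Complex.I * μ) • q⟫_ℂ).re := by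
    have h1 := congrArg Complex.re hparts
    have h2 : (⟪q, q⟫_ℂ).re = ‖q‖ ^ 2 := inner_self_eq_norm_sq (𝕜 := ℂ) q
    have h3 : (⟪q', y⟫_ℂ).re = (⟪y, q'⟫_ℂ).re := inner_re_symm (𝕜 := ℂ) _ _
    rw [hzq, Complex.add_re, Complex.neg_re, h2, h3] at h1
    rw [inner_sub_right, inner_smul_right, Complex.sub_re, Complex.mul_re]
    simp only [Complex.mul_re, Complex.mul_im, Complex.I_re, Complex.I_im, Complex.ofReal_re,
      Complex.ofReal_im, him]
    linarith
  have hcs : -(⟪y, q' - (Complex.I * μ) • q⟫_ℂ).re ≤ ‖y‖ * ‖q' - (Complex.I * μ) • q‖ :=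
    (neg_le_abs _).trans ((Complex.abs_re_le_norm _).trans (norm_inner_le_norm _ _))
  simp only
  rcases (norm_nonneg q).eq_or_lt with h0 | h0
  · rw [← h0]; positivity
  · refine le_of_mul_le_mul_right ?_ h0
    have := mul_le_mul_of_nonneg_right hny (norm_nonneg (q' - (Complex.I * μ) • q))
    nlinarith

/-! ### The damping operator -/

section Damping

variable (p : Params)

theorem coeFn_mulDamping (f : L2 p.L) :
    mulDamping p f =ᵐ[volume.restrict (Ioo 0 p.L)] fun x => (damping p x : ℂ) * f x :=
  (memLp_damping_mul p f).coeFn_toLp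

theorem inner_mulDamping_left (f g : L2 p.L) :
    ⟪mulDamping p f, g⟫_ℂ = ⟪f, mulDamping p g⟫_ℂ := by
  rw [L2.inner_def, L2.inner_def]
  refine integral_congr_ae ?_
  filter_upwards [coeFn_mulDamping p f, coeFn_mulDamping p g] with x h1 h2
  simp only [h1, h2, RCLike.inner_apply, map_mul, Complex.conj_ofReal]
  ring

theorem mulDamping_mulDamping (f : L2 p.L) :
    mulDamping p (mulDamping p f) = (p.a₀ : ℂ) • mulDamping p f := by
  refine Lp.ext ?_
  filter_upwards [coeFn_mulDamping p f, coeFn_mulDamping p (mulDamping p f),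
    Lp.coeFn_smul (p.a₀ : ℂ) (mulDamping p f)] with x h1 h2 h3
  rw [h2, h3, Pi.smul_apply, h1, smul_eq_mul]
  by_cases hx : x ∈ Ioo 0 p.β <;> simp [damping, hx]

/-- `a₀ ⟪f, a f⟫ = ‖a f‖²`, because `a² = a₀ a`. -/
theorem inner_mulDamping_self (f : L2 p.L) :
    p.a₀ * (⟪f, mulDamping p f⟫_ℂ).re = ‖mulDamping p f‖ ^ 2 := by
  have h : (⟪mulDamping p f, mulDamping p f⟫_ℂ).re = ‖mulDamping p f‖ ^ 2 :=
    inner_self_eq_norm_sq (𝕜 := ℂ) _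
  rw [← h, inner_mulDamping_left, mulDamping_mulDamping, inner_smul_right, Complex.re_ofReal_mul]

theorem re_inner_mulDamping_nonneg (f : L2 p.L) : 0 ≤ (⟪f, mulDamping p f⟫_ℂ).re := by
  have h := inner_mulDamping_self p f
  have := p.a₀_pos
  by_contra! hneg
  nlinarith [sq_nonneg ‖mulDamping p f‖]

theorem norm_mulDamping_le (f : L2 p.L) : ‖mulDamping p f‖ ≤ p.a₀ * ‖f‖ := by
  have h := inner_mulDamping_self p f
  have h2 : (⟪f, mulDamping p f⟫_ℂ).re ≤ ‖f‖ * ‖mulDamping p f‖ :=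
    re_inner_le_norm (𝕜 := ℂ) _ _
  rcases (norm_nonneg (mulDamping p f)).eq_or_lt with h0 | h0
  · rw [← h0]; have := p.a₀_pos; positivity
  · refine le_of_mul_le_mul_right ?_ h0
    have := mul_le_mul_of_nonneg_left h2 p.a₀_pos.le
    nlinarith

theorem continuous_mulDamping : Continuous (mulDamping p) :=
  AddMonoidHomClass.continuous_of_bound _ p.a₀ (norm_mulDamping_le p)

end Damping

/-! ### Completeness of the energy space -/

namespace State

variable {p : Params}

theorem v2_sub (U V : State p) : (U - V).v2 = U.v2 - V.v2 := rfl
theorem v3_sub (U V : State p) : (U - V).v3 = U.v3 - V.v3 := rfl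
theorem v4_sub (U V : State p) : (U - V).v4 = U.v4 - V.v4 := rfl
theorem v6_sub (U V : State p) : (U - V).v6 = U.v6 - V.v6 := rfl

theorem shear_apply (U : State p) :
    U.shear = dx U.v1 + (U.v3 : L2 p.L) + (p.l : ℂ) • (U.v5 : L2 p.L) := rfl

theorem axial_apply (U : State p) : U.axial = dx U.v5 - (p.l : ℂ) • (U.v1 : L2 p.L) := rfl

theorem norm_sq_eq (U : State p) : ‖U‖ ^ 2 = p.k₁ * ‖U.shear‖ ^ 2 + p.ρ₁ * ‖U.v2‖ ^ 2
    + p.k₂ * ‖dx U.v3‖ ^ 2 + p.ρ₂ * ‖U.v4‖ ^ 2 + p.k₃ * ‖U.axial‖ ^ 2 + p.ρ₁ * ‖U.v6‖ ^ 2 := by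
  have h : (⟪U, U⟫_ℂ).re = ‖U‖ ^ 2 := inner_self_eq_norm_sq (𝕜 := ℂ) U
  rw [← h, inner_eq, energyInner_self, Complex.ofReal_re]

/-- Each of the six quantities in the energy is controlled by the energy norm. -/
theorem exists_bound_energy (p : Params) : ∃ C, 0 ≤ C ∧ ∀ U : State p,
    ‖U.shear‖ ≤ C * ‖U‖ ∧ ‖U.v2‖ ≤ C * ‖U‖ ∧ ‖dx U.v3‖ ≤ C * ‖U‖ ∧ ‖U.v4‖ ≤ C * ‖U‖ ∧
      ‖U.axial‖ ≤ C * ‖U‖ ∧ ‖U.v6‖ ≤ C * ‖U‖ := by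
  have key : ∀ {c a b : ℝ}, 0 < c → 0 ≤ b → c * a ^ 2 ≤ b ^ 2 → a ≤ √(c⁻¹) * b := by
    intro c a b hc hb h
    refine le_of_sq_le_sq ?_ (by positivity)
    rw [mul_pow, Real.sq_sqrt (by positivity), inv_mul_eq_div, le_div_iff₀ hc]
    linarith
  have h1 := p.k₁_pos
  have h2 := p.ρ₁_pos
  have h3 := p.k₂_pos
  have h4 := p.ρ₂_pos
  have h5 := p.k₃_pos
  refine ⟨√(p.k₁⁻¹) + √(p.ρ₁⁻¹) + √(p.k₂⁻¹) + √(p.ρ₂⁻¹) + √(p.k₃⁻¹), by positivity, fun U => ?_⟩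
  have hU := U.norm_sq_eq
  have a1 := mul_nonneg h1.le (sq_nonneg ‖U.shear‖)
  have a2 := mul_nonneg h2.le (sq_nonneg ‖U.v2‖)
  have a3 := mul_nonneg h3.le (sq_nonneg ‖dx U.v3‖)
  have a4 := mul_nonneg h4.le (sq_nonneg ‖U.v4‖)
  have a5 := mul_nonneg h5.le (sq_nonneg ‖U.axial‖)
  have a6 := mul_nonneg h2.le (sq_nonneg ‖U.v6‖)
  have n := norm_nonneg U
  have s1 := Real.sqrt_nonneg p.k₁⁻¹
  have s2 := Real.sqrt_nonneg p.ρ₁⁻¹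
  have s3 := Real.sqrt_nonneg p.k₂⁻¹
  have s4 := Real.sqrt_nonneg p.ρ₂⁻¹
  have s5 := Real.sqrt_nonneg p.k₃⁻¹
  refine ⟨(key h1 n (by linarith)).trans ?_, (key h2 n (by linarith)).trans ?_,
    (key h3 n (by linarith)).trans ?_, (key h4 n (by linarith)).trans ?_,
    (key h5 n (by linarith)).trans ?_, (key h2 n (by linarith)).trans ?_⟩ <;>
  exact mul_le_mul_of_nonneg_right (by linarith) n

/-- The displacements are controlled by the energy. The combinations `w = v¹ ± i v⁵` satisfy
`w' ∓ i l w = (shear - v³) ± i axial`, so that the gauge transformed Poincaré inequality applies. -/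
theorem exists_bound_displacement (p : Params) : ∃ C, ∀ U : State p,
    ‖(U.v1 : L2 p.L)‖ ≤ C * ‖U‖ ∧ ‖(U.v3 : L2 p.L)‖ ≤ C * ‖U‖ ∧
      ‖(U.v5 : L2 p.L)‖ ≤ C * ‖U‖ := by
  obtain ⟨C, hC, hb⟩ := exists_bound_energy p
  have hL := p.L_pos
  refine ⟨2 * p.L * (2 * C + 2 * p.L * C), fun U => ?_⟩
  obtain ⟨bS, -, bB, -, bN, -⟩ := hb U
  have hv3 : ‖(U.v3 : L2 p.L)‖ ≤ 2 * p.L * (C * ‖U‖) := by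
    have := poincare hL 0 U.v3
    rw [Complex.ofReal_zero, mul_zero, zero_smul, sub_zero] at this
    exact this.trans (by gcongr)
  have hd1 : dx U.v1 = U.shear - (U.v3 : L2 p.L) - (p.l : ℂ) • (U.v5 : L2 p.L) := by
    rw [shear_apply]; abel
  have hd5 : dx U.v5 = U.axial + (p.l : ℂ) • (U.v1 : L2 p.L) := by
    rw [axial_apply]; abel
  have hsum : ∀ ε : ℂ, ‖ε‖ = 1 → ‖(U.shear - (U.v3 : L2 p.L)) + ε • U.axial‖
      ≤ (2 * C + 2 * p.L * C) * ‖U‖ := by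
    intro ε hε
    have t1 := norm_add_le (U.shear - (U.v3 : L2 p.L)) (ε • U.axial)
    have t2 := norm_sub_le U.shear (U.v3 : L2 p.L)
    rw [norm_smul, hε, one_mul] at t1
    linarith
  have hplus : ‖(U.v1 : L2 p.L) + Complex.I • (U.v5 : L2 p.L)‖
      ≤ 2 * p.L * ((2 * C + 2 * p.L * C) * ‖U‖) := by
    have h1 := poincare hL p.l (U.v1 + Complex.I • U.v5)
    have h2 : dx (U.v1 + Complex.I • U.v5)
        - (Complex.I * p.l) • ((U.v1 + Complex.I • U.v5 : H10 p.L) : L2 p.L)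
        = (U.shear - (U.v3 : L2 p.L)) + Complex.I • U.axial := by
      rw [map_add, map_smul, hd1, hd5, Submodule.coe_add, Submodule.coe_smul, smul_add, smul_add,
        smul_smul, smul_smul, mul_right_comm, Complex.I_mul_I]
      module
    rw [h2] at h1
    refine h1.trans ?_
    have := hsum Complex.I Complex.norm_I
    gcongr
  have hminus : ‖(U.v1 : L2 p.L) - Complex.I • (U.v5 : L2 p.L)‖
      ≤ 2 * p.L * ((2 * C + 2 * p.L * C) * ‖U‖) := by
    have h1 := poincare hL (-p.l) (U.v1 - Complex.I • U.v5)
    have h2 : dx (U.v1 - Complex.I • U.v5)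
        - (Complex.I * ((-p.l : ℝ) : ℂ)) • ((U.v1 - Complex.I • U.v5 : H10 p.L) : L2 p.L)
        = (U.shear - (U.v3 : L2 p.L)) + (-Complex.I) • U.axial := by
      rw [map_sub, map_smul, hd1, hd5, Submodule.coe_sub, Submodule.coe_smul, smul_add, smul_sub,
        smul_smul, smul_smul, mul_right_comm, Complex.I_mul_I]
      push_cast
      module
    rw [h2] at h1
    refine h1.trans ?_
    have := hsum (-Complex.I) (by simp)
    gcongr
  refine ⟨?_, ?_, ?_⟩
  · have h2 : (2 : ℂ) • (U.v1 : L2 p.L) = ((U.v1 : L2 p.L) + Complex.I • (U.v5 : L2 p.L))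
        + ((U.v1 : L2 p.L) - Complex.I • (U.v5 : L2 p.L)) := by module
    have h3 := (congrArg norm h2).le.trans (norm_add_le _ _)
    rw [norm_smul, Complex.norm_ofNat] at h3
    linarith
  · refine hv3.trans ?_
    have : 0 ≤ p.L * C * ‖U‖ := by positivity
    have : 0 ≤ p.L * (p.L * C * ‖U‖) := by positivity
    linarith
  · have h2 : (2 * Complex.I) • (U.v5 : L2 p.L) = ((U.v1 : L2 p.L) + Complex.I • (U.v5 : L2 p.L))
        - ((U.v1 : L2 p.L) - Complex.I • (U.v5 : L2 p.L)) := by module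
    have h3 := (congrArg norm h2).le.trans (norm_sub_le _ _)
    rw [norm_smul, norm_mul, Complex.norm_ofNat, Complex.norm_I] at h3
    linarith

theorem uniformContinuous_of_bound {f : State p → L2 p.L} (hsub : ∀ U V, f (U - V) = f U - f V)
    {C : ℝ} (hb : ∀ U, ‖f U‖ ≤ C * ‖U‖) : UniformContinuous f :=
  (LipschitzWith.of_dist_le' (K := C) fun U V => by
    rw [dist_eq_norm, dist_eq_norm, ← hsub]; exact hb _).uniformContinuous

theorem uniformContinuous_v1 : UniformContinuous fun U : State p => (U.v1 : L2 p.L) :=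
  uniformContinuous_of_bound (fun _ _ => rfl) fun U =>
    ((exists_bound_displacement p).choose_spec U).1

theorem uniformContinuous_v2 : UniformContinuous fun U : State p => U.v2 :=
  uniformContinuous_of_bound (fun _ _ => rfl) fun U =>
    ((exists_bound_energy p).choose_spec.2 U).2.1

theorem uniformContinuous_v3 : UniformContinuous fun U : State p => (U.v3 : L2 p.L) :=
  uniformContinuous_of_bound (fun _ _ => rfl) fun U =>
    ((exists_bound_displacement p).choose_spec U).2.1

theorem uniformContinuous_v4 : UniformContinuous fun U : State p => U.v4 :=
  uniformContinuous_of_bound (fun _ _ => rfl) fun U =>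
    ((exists_bound_energy p).choose_spec.2 U).2.2.2.1

theorem uniformContinuous_v5 : UniformContinuous fun U : State p => (U.v5 : L2 p.L) :=
  uniformContinuous_of_bound (fun _ _ => rfl) fun U =>
    ((exists_bound_displacement p).choose_spec U).2.2

theorem uniformContinuous_v6 : UniformContinuous fun U : State p => U.v6 :=
  uniformContinuous_of_bound (fun _ _ => rfl) fun U =>
    ((exists_bound_energy p).choose_spec.2 U).2.2.2.2.2

theorem uniformContinuous_shear : UniformContinuous fun U : State p => U.shear :=
  uniformContinuous_of_bound (fun U V => map_sub _ U V) fun U =>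
    ((exists_bound_energy p).choose_spec.2 U).1

theorem uniformContinuous_axial : UniformContinuous fun U : State p => U.axial :=
  uniformContinuous_of_bound (fun U V => map_sub _ U V) fun U =>
    ((exists_bound_energy p).choose_spec.2 U).2.2.2.2.1

theorem uniformContinuous_dx_v3 : UniformContinuous fun U : State p => dx U.v3 :=
  uniformContinuous_of_bound (fun U V => map_sub _ U.v3 V.v3) fun U =>
    ((exists_bound_energy p).choose_spec.2 U).2.2.1

theorem completeSpace (p : Params) : CompleteSpace (State p) := by
  refine Metric.complete_of_cauchySeq_tendsto fun u hu => ?_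
  have lim : ∀ {f : State p → L2 p.L}, UniformContinuous f →
      ∃ a, Tendsto (fun n => f (u n)) atTop (𝓝 a) := fun hf =>
    cauchySeq_tendsto_of_complete (hf.comp_cauchySeq hu)
  obtain ⟨a1, h1⟩ := lim uniformContinuous_v1
  obtain ⟨a2, h2⟩ := lim uniformContinuous_v2
  obtain ⟨a3, h3⟩ := lim uniformContinuous_v3
  obtain ⟨a4, h4⟩ := lim uniformContinuous_v4
  obtain ⟨a5, h5⟩ := lim uniformContinuous_v5
  obtain ⟨a6, h6⟩ := lim uniformContinuous_v6
  obtain ⟨b, hb⟩ := lim uniformContinuous_dx_v3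
  obtain ⟨s, hs⟩ := lim uniformContinuous_shear
  obtain ⟨m, hm⟩ := lim uniformContinuous_axial
  obtain ⟨w3, e3, d3⟩ := exists_H10_of_tendsto h3 hb
  obtain ⟨w1, e1, d1⟩ := exists_H10_of_tendsto h1 (g := s - a3 - (p.l : ℂ) • a5) <| by
    refine ((hs.sub h3).sub (h5.const_smul (p.l : ℂ))).congr fun n => ?_
    rw [shear_apply]; abel
  obtain ⟨w5, e5, d5⟩ := exists_H10_of_tendsto h5 (g := m + (p.l : ℂ) • a1) <| by
    refine (hm.add (h1.const_smul (p.l : ℂ))).congr fun n => ?_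
    rw [axial_apply]; abel
  let U : State p := mk w1 a2 w3 a4 w5 a6
  have eS : U.shear = s := by
    change dx w1 + (w3 : L2 p.L) + (p.l : ℂ) • (w5 : L2 p.L) = s
    rw [d1, e3, e5]; abel
  have eN : U.axial = m := by
    change dx w5 - (p.l : ℂ) • (w1 : L2 p.L) = m
    rw [d5, e1]; abel
  have z : ∀ {f : ℕ → L2 p.L} {a : L2 p.L} (c : ℝ), Tendsto f atTop (𝓝 a) →
      Tendsto (fun n => c * ‖f n - a‖ ^ 2) atTop (𝓝 0) := by
    intro f a c hf
    simpa using ((tendsto_iff_norm_sub_tendsto_zero.1 hf).pow 2).const_mul c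
  refine ⟨U, ?_⟩
  rw [tendsto_iff_norm_sub_tendsto_zero]
  have hsq : Tendsto (fun n => ‖u n - U‖ ^ 2) atTop (𝓝 0) := by
    have h := (((((z p.k₁ hs).add (z p.ρ₁ h2)).add (z p.k₂ hb)).add (z p.ρ₂ h4)).add
      (z p.k₃ hm)).add (z p.ρ₁ h6)
    simp only [add_zero] at h
    refine h.congr fun n => ?_
    rw [norm_sq_eq, map_sub, map_sub, eS, eN, v2_sub, v3_sub, v4_sub, v6_sub, map_sub]
    change _ = p.k₁ * ‖(u n).shear - s‖ ^ 2 + p.ρ₁ * ‖(u n).v2 - a2‖ ^ 2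
      + p.k₂ * ‖dx (u n).v3 - dx w3‖ ^ 2 + p.ρ₂ * ‖(u n).v4 - a4‖ ^ 2
      + p.k₃ * ‖(u n).axial - m‖ ^ 2 + p.ρ₁ * ‖(u n).v6 - a6‖ ^ 2
    rw [d3]
  have := hsq.sqrt
  simpa using this

end State

/-! ### The Bresse operator is m-dissipative -/

section Operator

variable {p : Params}

/-- The energy identity: all terms but the damping cancel in real part. -/
theorem re_inner_opA (U : (opA p).domain) :
    (⟪(U : State p), opA p U⟫_ℂ).re
      = -(⟪(U : State p).v6, mulDamping p (U : State p).v6⟫_ℂ).re := by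
  set V : State p := U.1
  have hρ₁ : (p.ρ₁ : ℂ) ≠ 0 := by exact_mod_cast p.ρ₁_pos.ne'
  have hρ₂ : (p.ρ₂ : ℂ) ≠ 0 := by exact_mod_cast p.ρ₂_pos.ne'
  let w2 : H10 p.L := ⟨V.v2, U.2.1.2⟩
  let w4 : H10 p.L := ⟨V.v4, U.2.2.1.2⟩
  let w6 : H10 p.L := ⟨V.v6, U.2.2.2.2⟩
  have i2 : ⟪dx w2, V.shear⟫_ℂ = -⟪V.v2, shearDx U⟫_ℂ := inner_dx w2 ⟨V.shear, shear_mem U⟩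
  have i4 : ⟪dx w4, dx V.v3⟫_ℂ = -⟪V.v4, bendingDx U⟫_ℂ := inner_dx w4 ⟨dx V.v3, dx_v3_mem U⟩
  have i6 : ⟪dx w6, V.axial⟫_ℂ = -⟪V.v6, axialDx U⟫_ℂ := inner_dx w6 ⟨V.axial, axial_mem U⟩
  have e : ⟪V, opA p U⟫_ℂ
      = p.k₁ * ⟪V.shear, dx w2 + V.v4 + (p.l : ℂ) • V.v6⟫_ℂ
        + p.ρ₁ * ⟪V.v2, ((p.k₁ / p.ρ₁ : ℝ) : ℂ) • shearDx U
          + ((p.l * p.k₃ / p.ρ₁ : ℝ) : ℂ) • V.axial⟫_ℂ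
        + p.k₂ * ⟪dx V.v3, dx w4⟫_ℂ
        + p.ρ₂ * ⟪V.v4, ((p.k₂ / p.ρ₂ : ℝ) : ℂ) • bendingDx U
          - ((p.k₁ / p.ρ₂ : ℝ) : ℂ) • V.shear⟫_ℂ
        + p.k₃ * ⟪V.axial, dx w6 - (p.l : ℂ) • V.v2⟫_ℂ
        + p.ρ₁ * ⟪V.v6, ((p.k₃ / p.ρ₁ : ℝ) : ℂ) • axialDx U
          - ((p.l * p.k₁ / p.ρ₁ : ℝ) : ℂ) • V.shear
          - ((1 / p.ρ₁ : ℝ) : ℂ) • mulDamping p V.v6⟫_ℂ := rfl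
  have e' : ⟪V, opA p U⟫_ℂ
      = p.k₁ * (⟪V.shear, dx w2⟫_ℂ - ⟪dx w2, V.shear⟫_ℂ)
        + p.k₁ * (⟪V.shear, V.v4⟫_ℂ - ⟪V.v4, V.shear⟫_ℂ)
        + ((p.k₁ * p.l : ℝ) : ℂ) * (⟪V.shear, V.v6⟫_ℂ - ⟪V.v6, V.shear⟫_ℂ)
        + ((p.k₃ * p.l : ℝ) : ℂ) * (⟪V.v2, V.axial⟫_ℂ - ⟪V.axial, V.v2⟫_ℂ)
        + p.k₂ * (⟪dx V.v3, dx w4⟫_ℂ - ⟪dx w4, dx V.v3⟫_ℂ)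
        + p.k₃ * (⟪V.axial, dx w6⟫_ℂ - ⟪dx w6, V.axial⟫_ℂ)
        - ⟪V.v6, mulDamping p V.v6⟫_ℂ := by
    rw [e, i2, i4, i6]
    simp only [inner_add_right, inner_sub_right, inner_smul_right]
    push_cast
    field_simp
    ring
  have hre : ∀ (c : ℝ) (f g : L2 p.L), ((c : ℂ) * (⟪f, g⟫_ℂ - ⟪g, f⟫_ℂ)).re = 0 := by
    intro c f g
    have : (⟪f, g⟫_ℂ).re = (⟪g, f⟫_ℂ).re := inner_re_symm (𝕜 := ℂ) f g
    rw [Complex.re_ofReal_mul, Complex.sub_re, this, sub_self, mul_zero]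
  rw [e']
  simp only [Complex.sub_re _ ⟪V.v6, mulDamping p V.v6⟫_ℂ, Complex.add_re, hre]
  ring

/-- Multiplication by `r + c a`, where `a` is the damping coefficient. -/
noncomputable def affineDamping (p : Params) (r c : ℝ) : L2 p.L →ₗ[ℂ] L2 p.L :=
  (r : ℂ) • LinearMap.id + (c : ℂ) • mulDamping p

theorem affineDamping_apply (r c : ℝ) (f : L2 p.L) :
    affineDamping p r c f = (r : ℂ) • f + (c : ℂ) • mulDamping p f := rfl

theorem continuous_affineDamping (r c : ℝ) : Continuous (affineDamping p r c) :=
  (continuous_id.const_smul (r : ℂ)).add ((continuous_mulDamping p).const_smul (c : ℂ))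

theorem inner_affineDamping_left (r c : ℝ) (f g : L2 p.L) :
    ⟪affineDamping p r c f, g⟫_ℂ = ⟪f, affineDamping p r c g⟫_ℂ := by
  simp only [affineDamping_apply, inner_add_left, inner_add_right, inner_smul_left,
    inner_smul_right, Complex.conj_ofReal, inner_mulDamping_left]

theorem affineDamping_affineDamping (r c r' c' : ℝ) (f : L2 p.L) :
    affineDamping p r c (affineDamping p r' c' f)
      = affineDamping p (r * r') (r * c' + c * r' + c * c' * p.a₀) f := by
  simp only [affineDamping_apply, map_add, map_smul, mulDamping_mulDamping]
  push_cast
  module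

/-- The coefficients of `m = r + c a` and `1 / m = 1 / r + d a` for which
`m² = r² + (r / ρ₁) a`; recall that `a² = a₀ a`. -/
theorem exists_sqrt_coeff (p : Params) {r : ℝ} (hr : 0 < r) :
    ∃ c d : ℝ, r * c + c * r + c * c * p.a₀ = r / p.ρ₁ ∧ r * d + c * r⁻¹ + c * d * p.a₀ = 0 := by
  have ha := p.a₀_pos
  have hρ := p.ρ₁_pos
  have hs : 0 < √(r ^ 2 + r * p.a₀ / p.ρ₁) := Real.sqrt_pos.2 (by positivity)
  have hs2 : √(r ^ 2 + r * p.a₀ / p.ρ₁) ^ 2 = r ^ 2 + r * p.a₀ / p.ρ₁ :=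
    Real.sq_sqrt (by positivity)
  set s := √(r ^ 2 + r * p.a₀ / p.ρ₁)
  refine ⟨(s - r) / p.a₀, -((s - r) / p.a₀) / (r * s), ?_, ?_⟩
  · have : r / p.ρ₁ = (s ^ 2 - r ^ 2) / p.a₀ := by rw [hs2]; field_simp; ring
    rw [this]
    field_simp
    ring
  · field_simp
    ring

/-- The states `(v¹, r v¹, v³, r v³, v⁵, m v⁵)` with `m = r + c a`. -/
noncomputable def resolventSubspace (p : Params) (r c : ℝ) : Submodule ℂ (State p) where
  carrier := {U | U.v2 = (r : ℂ) • (U.v1 : L2 p.L) ∧ U.v4 = (r : ℂ) • (U.v3 : L2 p.L) ∧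
    U.v6 = affineDamping p r c U.v5}
  add_mem' := by
    rintro U V ⟨a1, a2, a3⟩ ⟨b1, b2, b3⟩
    refine ⟨?_, ?_, ?_⟩
    · rw [State.v2_add, State.v1_add, Submodule.coe_add, smul_add, a1, b1]
    · rw [State.v4_add, State.v3_add, Submodule.coe_add, smul_add, a2, b2]
    · rw [State.v6_add, State.v5_add, Submodule.coe_add, map_add, a3, b3]
  zero_mem' := ⟨by simp, by simp, by simp⟩
  smul_mem' := by
    rintro z U ⟨a1, a2, a3⟩
    refine ⟨?_, ?_, ?_⟩
    · rw [State.v2_smul, State.v1_smul, Submodule.coe_smul, smul_comm, a1]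
    · rw [State.v4_smul, State.v3_smul, Submodule.coe_smul, smul_comm, a2]
    · rw [State.v6_smul, State.v5_smul, Submodule.coe_smul, map_smul, a3]

theorem isClosed_resolventSubspace (r c : ℝ) :
    IsClosed (resolventSubspace p r c : Set (State p)) := by
  have h1 : Continuous fun U : State p => (U.v1 : L2 p.L) :=
    State.uniformContinuous_v1.continuous
  have h3 : Continuous fun U : State p => (U.v3 : L2 p.L) :=
    State.uniformContinuous_v3.continuous
  have h5 : Continuous fun U : State p => (U.v5 : L2 p.L) :=
    State.uniformContinuous_v5.continuous
  exact (isClosed_eq State.uniformContinuous_v2.continuous (h1.const_smul (r : ℂ))).inter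
    ((isClosed_eq State.uniformContinuous_v4.continuous (h3.const_smul (r : ℂ))).inter
      (isClosed_eq State.uniformContinuous_v6.continuous
        ((continuous_affineDamping r c).comp h5)))

/-- The variational form of the resolvent equation. On the states
`(v¹, r v¹, v³, r v³, v⁵, m v⁵)` with `m² = r² + (r / ρ₁) a` the energy inner product is the
left-hand side, and the right-hand side is the inner product with
`(0, g₁ / r, 0, g₃ / r, 0, g₅ / m)`. The solution is the orthogonal projection of the latter. -/
theorem exists_variational_solution (p : Params) {r : ℝ} (hr : 0 < r) (g1 g3 g5 : L2 p.L) :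
    ∃ v1 v3 v5 : H10 p.L, ∀ w1 w3 w5 : H10 p.L,
      (p.k₁ : ℂ) * ⟪dx w1 + (w3 : L2 p.L) + (p.l : ℂ) • (w5 : L2 p.L),
          dx v1 + (v3 : L2 p.L) + (p.l : ℂ) • (v5 : L2 p.L)⟫_ℂ
        + p.ρ₁ * ⟪(w1 : L2 p.L), ((r ^ 2 : ℝ) : ℂ) • (v1 : L2 p.L)⟫_ℂ
        + p.k₂ * ⟪dx w3, dx v3⟫_ℂ
        + p.ρ₂ * ⟪(w3 : L2 p.L), ((r ^ 2 : ℝ) : ℂ) • (v3 : L2 p.L)⟫_ℂ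
        + p.k₃ * ⟪dx w5 - (p.l : ℂ) • (w1 : L2 p.L), dx v5 - (p.l : ℂ) • (v1 : L2 p.L)⟫_ℂ
        + p.ρ₁ * ⟪(w5 : L2 p.L), affineDamping p (r ^ 2) (r / p.ρ₁) v5⟫_ℂ
      = p.ρ₁ * ⟪(w1 : L2 p.L), g1⟫_ℂ + p.ρ₂ * ⟪(w3 : L2 p.L), g3⟫_ℂ
        + p.ρ₁ * ⟪(w5 : L2 p.L), g5⟫_ℂ := by
  obtain ⟨c, d, hc, hd⟩ := exists_sqrt_coeff p hr
  have := State.completeSpace p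
  have : CompleteSpace (resolventSubspace p r c) :=
    (isClosed_resolventSubspace r c).completeSpace_coe
  let G : State p := State.mk 0 ((r⁻¹ : ℂ) • g1) 0 ((r⁻¹ : ℂ) • g3) 0 (affineDamping p r⁻¹ d g5)
  let V : State p := (resolventSubspace p r c).starProjection G
  have hV : V ∈ resolventSubspace p r c := Submodule.starProjection_apply_mem _ _
  refine ⟨V.v1, V.v3, V.v5, fun w1 w3 w5 => ?_⟩
  let W : State p := State.mk w1 ((r : ℂ) • (w1 : L2 p.L)) w3 ((r : ℂ) • (w3 : L2 p.L)) w5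
    (affineDamping p r c w5)
  have hW : W ∈ resolventSubspace p r c := ⟨rfl, rfl, rfl⟩
  have horth : ⟪W, V⟫_ℂ = ⟪W, G⟫_ℂ := by
    have h1 := Submodule.sub_starProjection_mem_orthogonal (K := resolventSubspace p r c) G W hW
    rw [inner_sub_right, sub_eq_zero] at h1
    exact h1.symm
  have hG : ⟪W, G⟫_ℂ = p.ρ₁ * ⟪(r : ℂ) • (w1 : L2 p.L), (r⁻¹ : ℂ) • g1⟫_ℂ
      + p.ρ₂ * ⟪(r : ℂ) • (w3 : L2 p.L), (r⁻¹ : ℂ) • g3⟫_ℂ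
      + p.ρ₁ * ⟪affineDamping p r c w5, affineDamping p r⁻¹ d g5⟫_ℂ := by
    have e1 : G.shear = 0 := by simp [State.shear_apply, G]
    have e2 : G.axial = 0 := by simp [State.axial_apply, G]
    have e3 : dx G.v3 = 0 := map_zero dx
    rw [State.inner_eq, State.energyInner, e1, e2, e3]
    simp only [inner_zero_right, mul_zero, zero_add, add_zero]
    rfl
  have hrc : (r : ℂ) ≠ 0 := by exact_mod_cast hr.ne'
  have hs : ∀ f g : L2 p.L, ⟪(r : ℂ) • f, (r⁻¹ : ℂ) • g⟫_ℂ = ⟪f, g⟫_ℂ := by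
    intro f g
    rw [inner_smul_left, inner_smul_right, Complex.conj_ofReal, ← mul_assoc,
      mul_inv_cancel₀ hrc, one_mul]
  have hm : affineDamping p r c (affineDamping p r⁻¹ d g5) = g5 := by
    rw [affineDamping_affineDamping, hd, mul_inv_cancel₀ hr.ne', affineDamping_apply]
    simp
  rw [inner_affineDamping_left, hm, hs, hs] at hG
  have h2 : ⟪(w1 : L2 p.L), ((r ^ 2 : ℝ) : ℂ) • (V.v1 : L2 p.L)⟫_ℂ = ⟪W.v2, V.v2⟫_ℂ := by
    rw [hV.1]
    change _ = ⟪(r : ℂ) • (w1 : L2 p.L), _⟫_ℂ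
    simp only [inner_smul_left, inner_smul_right, Complex.conj_ofReal]
    push_cast
    ring
  have h4 : ⟪(w3 : L2 p.L), ((r ^ 2 : ℝ) : ℂ) • (V.v3 : L2 p.L)⟫_ℂ = ⟪W.v4, V.v4⟫_ℂ := by
    rw [hV.2.1]
    change _ = ⟪(r : ℂ) • (w3 : L2 p.L), _⟫_ℂ
    simp only [inner_smul_left, inner_smul_right, Complex.conj_ofReal]
    push_cast
    ring
  have h6 : ⟪(w5 : L2 p.L), affineDamping p (r ^ 2) (r / p.ρ₁) V.v5⟫_ℂ = ⟪W.v6, V.v6⟫_ℂ := by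
    rw [hV.2.2]
    change _ = ⟪affineDamping p r c w5, _⟫_ℂ
    rw [inner_affineDamping_left, affineDamping_affineDamping, hc, sq]
  rw [h2, h4, h6, ← hG, ← horth]
  rfl

/-- Elliptic regularity is immediate here: the variational equation says that the shear, bending
and axial strains have weak derivatives in `L²`, hence that the displacements are in `H²`. -/
theorem opA_surjective (p : Params) {r : ℝ} (hr : 0 < r) (F : State p) :
    ∃ U : (opA p).domain, (r : ℂ) • (U : State p) - opA p U = F := by
  have hk₁ : (p.k₁ : ℂ) ≠ 0 := by exact_mod_cast p.k₁_pos.ne'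
  have hk₂ : (p.k₂ : ℂ) ≠ 0 := by exact_mod_cast p.k₂_pos.ne'
  have hk₃ : (p.k₃ : ℂ) ≠ 0 := by exact_mod_cast p.k₃_pos.ne'
  have hρ₁ : (p.ρ₁ : ℂ) ≠ 0 := by exact_mod_cast p.ρ₁_pos.ne'
  have hρ₂ : (p.ρ₂ : ℂ) ≠ 0 := by exact_mod_cast p.ρ₂_pos.ne'
  -- Eliminating `v² = r v¹ - f¹`, `v⁴ = r v³ - f³` and `v⁶ = r v⁵ - f⁵` leaves these data.
  set g1 : L2 p.L := F.v2 + (r : ℂ) • (F.v1 : L2 p.L) with hg1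
  set g3 : L2 p.L := F.v4 + (r : ℂ) • (F.v3 : L2 p.L) with hg3
  set g5 : L2 p.L := F.v6 + (r : ℂ) • (F.v5 : L2 p.L)
    + ((1 / p.ρ₁ : ℝ) : ℂ) • mulDamping p F.v5 with hg5
  obtain ⟨v1, v3, v5, hv⟩ := exists_variational_solution p hr g1 g3 g5
  set S : L2 p.L := dx v1 + (v3 : L2 p.L) + (p.l : ℂ) • (v5 : L2 p.L) with hS
  set N : L2 p.L := dx v5 - (p.l : ℂ) • (v1 : L2 p.L) with hN
  set s : L2 p.L := (p.k₁⁻¹ : ℂ) • ((p.ρ₁ * r ^ 2 : ℂ) • (v1 : L2 p.L)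
    - (p.k₃ * p.l : ℂ) • N - (p.ρ₁ : ℂ) • g1) with hs
  set b : L2 p.L := (p.k₂⁻¹ : ℂ) • ((p.ρ₂ * r ^ 2 : ℂ) • (v3 : L2 p.L)
    + (p.k₁ : ℂ) • S - (p.ρ₂ : ℂ) • g3) with hb
  set n : L2 p.L := (p.k₃⁻¹ : ℂ) • ((p.ρ₁ * r ^ 2 : ℂ) • (v5 : L2 p.L)
    + (r : ℂ) • mulDamping p v5 + (p.k₁ * p.l : ℂ) • S - (p.ρ₁ : ℂ) • g5) with hn
  have dS : IsWeakDeriv p.L S s := by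
    refine isWeakDeriv_iff_inner.2 fun w => mul_left_cancel₀ hk₁ ?_
    have h := hv w 0 0
    simp only [map_zero, Submodule.coe_zero, smul_zero, add_zero, inner_zero_left, mul_zero,
      zero_sub, inner_neg_left, inner_smul_left, inner_smul_right, Complex.conj_ofReal] at h
    simp only [hs, inner_sub_right, inner_smul_right]
    push_cast at h
    field_simp
    linear_combination h
  have dB : IsWeakDeriv p.L (dx v3) b := by
    refine isWeakDeriv_iff_inner.2 fun w => mul_left_cancel₀ hk₂ ?_
    have h := hv 0 w 0
    simp only [map_zero, Submodule.coe_zero, smul_zero, add_zero, zero_add, inner_zero_left,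
      mul_zero, sub_zero, inner_smul_right] at h
    simp only [hb, inner_sub_right, inner_add_right, inner_smul_right]
    push_cast at h
    field_simp
    linear_combination h
  have dN : IsWeakDeriv p.L N n := by
    refine isWeakDeriv_iff_inner.2 fun w => mul_left_cancel₀ hk₃ ?_
    have h := hv 0 0 w
    simp only [map_zero, Submodule.coe_zero, smul_zero, add_zero, zero_add, inner_zero_left,
      mul_zero, sub_zero, inner_smul_left, inner_smul_right, Complex.conj_ofReal,
      affineDamping_apply, inner_add_right] at h
    simp only [hn, inner_sub_right, inner_add_right, inner_smul_right]
    push_cast at h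
    field_simp at h ⊢
    linear_combination h
  have m1 : MemH2 p.L v1 := by
    refine ⟨H10_le_H1 _ v1.2, ?_⟩
    have : dx v1 = S - (v3 : L2 p.L) - (p.l : ℂ) • (v5 : L2 p.L) := by rw [hS]; abel
    change dx v1 ∈ _
    rw [this]
    exact sub_mem (sub_mem (mem_H1_of_isWeakDeriv dS) (H10_le_H1 _ v3.2))
      (Submodule.smul_mem _ _ (H10_le_H1 _ v5.2))
  have m3 : MemH2 p.L v3 := ⟨H10_le_H1 _ v3.2, mem_H1_of_isWeakDeriv dB⟩
  have m5 : MemH2 p.L v5 := by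
    refine ⟨H10_le_H1 _ v5.2, ?_⟩
    have : dx v5 = N + (p.l : ℂ) • (v1 : L2 p.L) := by rw [hN]; abel
    change dx v5 ∈ _
    rw [this]
    exact add_mem (mem_H1_of_isWeakDeriv dN) (Submodule.smul_mem _ _ (H10_le_H1 _ v1.2))
  let u2 : H10 p.L := (r : ℂ) • v1 - F.v1
  let u4 : H10 p.L := (r : ℂ) • v3 - F.v3
  let u6 : H10 p.L := (r : ℂ) • v5 - F.v5
  let U : (opA p).domain := ⟨State.mk v1 u2 v3 u4 v5 u6, ⟨m1, u2.2⟩, ⟨m3, u4.2⟩, m5, u6.2⟩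
  have eS : shearDx U = s := weakDeriv_eq ⟨S, _⟩ dS
  have eB : bendingDx U = b := weakDeriv_eq ⟨dx v3, _⟩ dB
  have eN : axialDx U = n := weakDeriv_eq ⟨N, _⟩ dN
  refine ⟨U, State.ext ?_ ?_ ?_ ?_ ?_ ?_⟩
  · change (r : ℂ) • v1 - u2 = F.v1
    simp only [u2]; abel
  · change (r : ℂ) • (((r : ℂ) • (v1 : L2 p.L)) - (F.v1 : L2 p.L))
      - (((p.k₁ / p.ρ₁ : ℝ) : ℂ) • shearDx U + ((p.l * p.k₃ / p.ρ₁ : ℝ) : ℂ) • N) = F.v2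
    rw [eS, hs, hg1]
    push_cast
    match_scalars <;> field_simp <;> ring
  · change (r : ℂ) • v3 - u4 = F.v3
    simp only [u4]; abel
  · change (r : ℂ) • (((r : ℂ) • (v3 : L2 p.L)) - (F.v3 : L2 p.L))
      - (((p.k₂ / p.ρ₂ : ℝ) : ℂ) • bendingDx U - ((p.k₁ / p.ρ₂ : ℝ) : ℂ) • S) = F.v4
    rw [eB, hb, hg3]
    push_cast
    match_scalars <;> field_simp <;> ring
  · change (r : ℂ) • v5 - u6 = F.v5
    simp only [u6]; abel
  · change (r : ℂ) • (((r : ℂ) • (v5 : L2 p.L)) - (F.v5 : L2 p.L))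
      - (((p.k₃ / p.ρ₁ : ℝ) : ℂ) • axialDx U - ((p.l * p.k₁ / p.ρ₁ : ℝ) : ℂ) • S
        - ((1 / p.ρ₁ : ℝ) : ℂ) • mulDamping p (((r : ℂ) • (v5 : L2 p.L)) - (F.v5 : L2 p.L)))
      = F.v6
    rw [eN, hn, hg5, map_sub, map_smul]
    push_cast
    match_scalars <;> field_simp <;> ring

theorem isMDissipative_opA (p : Params) : IsMDissipative (opA p) :=
  ⟨fun U => by
    rw [re_inner_opA]
    exact neg_nonpos.2 (re_inner_mulDamping_nonneg p _), fun _ hr F => opA_surjective p hr F⟩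

end Operator

end Bresse

theorem mainTheorem5 (p : Bresse.Params) :
    CompleteSpace (Bresse.State p) ∧
    Dense ((Bresse.opA p).domain : Set (Bresse.State p)) ∧
    Bresse.IsMDissipative (Bresse.opA p) ∧
    ∃ T : ℝ → Bresse.State p →L[ℂ] Bresse.State p,
      Bresse.IsC0ContractionSemigroup T ∧
      Bresse.IsGenerator (Bresse.opA p) T ∧
      (∀ U₀ : Bresse.State p,
        Bresse.IsWeakSolution (Bresse.opA p) U₀ (fun t => T t U₀) ∧
        ∀ U : ℝ → Bresse.State p, Bresse.IsWeakSolution (Bresse.opA p) U₀ U →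
          ∀ t : ℝ, 0 ≤ t → U t = T t U₀) ∧
      (∀ U₀ : Bresse.State p, U₀ ∈ (Bresse.opA p).domain →
        Bresse.IsStrongSolution (Bresse.opA p) U₀ (fun t => T t U₀) ∧
        ∀ U : ℝ → Bresse.State p, Bresse.IsStrongSolution (Bresse.opA p) U₀ U →
          ∀ t : ℝ, 0 ≤ t → U t = T t U₀) :=
  have := Bresse.State.completeSpace p
  have h := Bresse.isMDissipative_opA p
  ⟨this, h.dense_domain, h, h.semigroup, h.isC0ContractionSemigroup, h.isGenerator_semigroup,
    fun U₀ => ⟨h.isWeakSolution_semigroup U₀,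
      fun _ hU _ ht => h.weakSolution_unique hU (h.isWeakSolution_semigroup U₀) ht⟩,
    fun U₀ hU₀ => ⟨h.isStrongSolution_semigroup hU₀,
      fun _ hU _ ht => h.weakSolution_unique hU.isWeakSolution
        (h.isWeakSolution_semigroup U₀) ht⟩⟩
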